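/- **Solution Independence.** Fix a function-free first-order signature with set of predicate symbols $\mathbf P$ and set of constants $\Delta$. Formulae are built from atoms $P(t_1,\dots,t_m)$ by $\lnot,\land,\exists$ and the modalities $\mathbf K,\mathbf{not}$ (no equality, no truth constants); $\mathrm{pr}(\cdot)$ is the set of predicate symbols that occur. An interpretation is a set of ground atoms, $\mathcal I$ is the set of all of them, and an MKNF interpretation is a nonempty subset of $\mathcal I$. For $I\in\mathcal I$, $M,N\subseteq\mathcal I$: $(I,M,N)\models p$ iff $p\in I$ for ground atoms $p$; $\lnot,\land$ are as usual; $\exists x\,\phi$ holds iff $\phi[c/x]$ holds for some $c\in\Delta$; $(I,M,N)\models\mathbf K\phi$ iff $(J,M,N)\models\phi$ for all $J\in M$; $(I,M,N)\models\mathbf{not}\,\phi$ iff $(J,M,N)\not\models\phi$ for some $J\in N$. For a set $T$ of sentences, $M\models T$ means $(I,M,M)\models\phi$ for all $\phi\in T$, $I\in M$; for a first-order theory $T$, $\mathsf{mod}(T)$ is the greatest $M\subseteq\mathcal I$ with $M\models T$. *Knowledge bases.* A literal $L$ is a ground atom $p$ or a default literal $\sim p$, with $\sim\sim p=p$, $\pi(p)=\mathbf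 Kp$, $\pi(\sim p)=\mathbf{not}\,p$. A rule $r$ has a literal $H(r)$ as head and a finite set $B(r)$ of literals as body; it is positive if $H(r)$ is an atom and a fact if $B(r)=\emptyset$. A hybrid knowledge base is a pair $\mathcal K=\langle\mathcal O,\mathcal P\rangle$ of a set $\mathcal O$ of axioms of a description logic, each axiom $\phi$ having a translation $\kappa(\phi)$ into a first-order sentence and $\mathrm{pr}(\phi)=\mathrm{pr}(\kappa(\phi))$, and a set $\mathcal P$ of rules. A dynamic hybrid knowledge base is a finite sequence $\mathcal K=\langle\mathcal K_i\rangle_{i<n}$, $\mathcal K_i=\langle\mathcal O_i,\mathcal P_i\rangle$; operations on hybrid knowledge bases are applied to it componentwise. *Basic updates.* For a predicate symbol $P$ let $\mathrm{diff}(P,I,J)$ be the set of ground atoms with predicate symbol $P$ that lie in exactly one of $I,J$. Write $J\le_I J'$ if $\mathrm{diff}(P,I,J)\subseteq\mathrm{diff}(P,I,J')$ for all $P$, and $J<_IJ'$ if $J\le_IJ'$ and not $J'\le_IJ$. Put $M\oplus N=\bigcup_{I\in M}\{J\in N: \text{there is no } J'\in N \text{ with } J'<_IJ\}$. The minimal change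 update model of first-order theories $\langle T_i\rangle_{i<n}$ is $(\cdots(\mathcal I\oplus\mathsf{mod}(T_0))\oplus\cdots)\oplus\mathsf{mod}(T_{n-1})$, provided that it is nonempty. An interpretation $I$ is a dynamic stable model of programs $\langle\mathcal P_i\rangle_{i<n}$ if $I\cup\{\sim p: p\notin I\}$ is the least model, with each $\sim p$ read as a fresh atom, of the program that consists of all $r$ that have an unrejected occurrence $r\in\mathcal P_i$ for some $i$, where this occurrence is rejected if some $r'\in\mathcal P_j$ with $i\le j$ satisfies $H(r)=\,\sim H(r')$ and $I\models B(r')$, together with the facts $\sim p$ for all ground atoms $p$ such that no rule $r$ of any $\mathcal P_i$ has $H(r)=p$ and $I\models B(r)$. An MKNF interpretation $M$ is a dynamic MKNF model of a basic $\mathcal K$ if either all rules of all $\mathcal P_i$ are positive facts and $M$ is the minimal change update model of $\langle\kappa(\mathcal O_i)\cup\mathcal P_i\rangle_{i<n}$, or all $\mathcal O_i$ are empty and $M=\{J\in\mathcal I: I\subseteq J\}$ for a dynamic stable model $I$ of $\langle\mathcal P_i\rangle_{i<n}$. *Splitting.* $U\subseteq\mathbf P$ is a splitting set for $\langle\mathcal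 O,\mathcal P\rangle$ if every $\phi\in\mathcal O$ with $\mathrm{pr}(\phi)\cap U\ne\emptyset$ has $\mathrm{pr}(\phi)\subseteq U$ and every $r\in\mathcal P$ with $\mathrm{pr}(H(r))\cap U\neq\emptyset$ has $\mathrm{pr}(r)\subseteq U$. The bottom $b_U$ keeps the axioms and rules with all predicate symbols in $U$, and the top $t_U$ keeps the others. For $X\subseteq\mathcal I$, the reduct $e_U(\langle\mathcal O,\mathcal P\rangle,X)$ consists of $t_U(\mathcal O)$ and of all rules $H(r)\leftarrow\{L\in B(r):\mathrm{pr}(L)\subseteq\mathbf P\setminus U\}$ with $r\in t_U(\mathcal P)$ and $X\models\pi(\{L\in B(r):\mathrm{pr}(L)\subseteq U\})$. A splitting sequence for a hybrid knowledge base is a transfinite sequence $U=\langle U_\alpha\rangle_{\alpha<\mu}$ of splitting sets that is monotone and continuous ($U_\alpha=\bigcup_{\eta<\alpha}U_\eta$ at limit ordinals $\alpha<\mu$) with $\bigcup_{\alpha<\mu}U_\alpha=\mathbf P$; it is one for a dynamic $\mathcal K$ if it is one for every $\mathcal K_i$. A dynamic $\mathcal K$ is reducible relative to $W\subseteq\mathbf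 P$ if either all its rules $r$ are positive with $\mathrm{pr}(B(r))\subseteq W$, or all its ontologies are empty. A splitting sequence $U$ is update-enabling for $\mathcal K$ if $b_{U_0}(\mathcal K)$ is reducible relative to $\emptyset$ and, whenever $\alpha+1<\mu$, $t_{U_\alpha}(b_{U_{\alpha+1}}(\mathcal K))$ is reducible relative to $U_\alpha$. $\mathcal K$ is updatable if it has an update-enabling splitting sequence. *Models.* An MKNF interpretation $M$ is a dynamic MKNF model of $\mathcal K$ with respect to $U$ if $M=\bigcap_{\alpha<\mu}X_\alpha$ for some MKNF interpretations $\langle X_\alpha\rangle_{\alpha<\mu}$ such that $X_0$ is a dynamic MKNF model of the basic $b_{U_0}(\mathcal K)$; $X_{\alpha+1}$ is a dynamic MKNF model of the basic $e_{U_\alpha}(b_{U_{\alpha+1}}(\mathcal K),\bigcap_{\eta\le\alpha}X_\eta)$ whenever $\alpha+1<\mu$; and $X_\alpha=\mathcal I$ for limit ordinals $\alpha<\mu$. $M$ is a dynamic MKNF model of an updatable $\mathcal K$ if it is one with respect to some update-enabling splitting sequence for $\mathcal K$. **Proposition.** Let $U,V$ be update-enabling splitting sequences for a dynamic hybrid knowledge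 base $\mathcal K$. Then for every $M$: $M$ is a dynamic MKNF model of $\mathcal K$ with respect to $U$ if and only if $M$ is a dynamic MKNF model of $\mathcal K$ with respect to $V$. Consequently, the dynamic MKNF models of $\mathcal K$ are exactly its dynamic MKNF models with respect to $U$. -/

import Mathlib

universe u v w o o'

namespace HybridMKNF

/-- A function-free first-order signature: predicate symbols with arities, and constants.
By the standard names assumption the Herbrand universe is the set of constants. -/
structure Signature where
  Pred : Type u
  arity : Pred → ℕ
  Const : Type v

variable {σ : Signature.{u, v}}

/-! ### MKNF formulae -/

/-- Terms whose free variables are among `n` given ones. -/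
inductive Term (σ : Signature.{u, v}) (n : ℕ) : Type v
  | const (c : σ.Const) : Term σ n
  | var (i : Fin n) : Term σ n

/-- MKNF formulae whose free variables are among `n` given ones;
`ex` binds the last variable, `know` is the modality **K**, `naf` the modality **not**. -/
inductive Formula (σ : Signature.{u, v}) : ℕ → Type (max u v)
  | atom {n : ℕ} (P : σ.Pred) (t : Fin (σ.arity P) → Term σ n) : Formula σ n
  | neg {n : ℕ} (φ : Formula σ n) : Formula σ n
  | conj {n : ℕ} (φ ψ : Formula σ n) : Formula σ n
  | ex {n : ℕ} (φ : Formula σ (n + 1)) : Formula σ n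
  | know {n : ℕ} (φ : Formula σ n) : Formula σ n
  | naf {n : ℕ} (φ : Formula σ n) : Formula σ n

abbrev Sentence (σ : Signature.{u, v}) := Formula σ 0

/-- The set of predicate symbols relevant to a formula. -/
def Formula.preds : {n : ℕ} → Formula σ n → Set σ.Pred
  | _, .atom P _ => {P}
  | _, .neg φ => φ.preds
  | _, .conj φ ψ => φ.preds ∪ ψ.preds
  | _, .ex φ => φ.preds
  | _, .know φ => φ.preds
  | _, .naf φ => φ.preds

/-- A formula is first-order if it contains no modal operator. -/
def Formula.IsFirstOrder : {n : ℕ} → Formula σ n → Prop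
  | _, .atom _ _ => True
  | _, .neg φ => φ.IsFirstOrder
  | _, .conj φ ψ => φ.IsFirstOrder ∧ ψ.IsFirstOrder
  | _, .ex φ => φ.IsFirstOrder
  | _, .know _ => False
  | _, .naf _ => False

/-- First-order sentences. -/
def FOSentence (σ : Signature.{u, v}) := {φ : Sentence σ // φ.IsFirstOrder}

/-! ### Herbrand interpretations and MKNF satisfaction -/

/-- Ground atoms. -/
structure GroundAtom (σ : Signature.{u, v}) where
  pred : σ.Pred
  args : Fin (σ.arity pred) → σ.Const

/-- A Herbrand interpretation is a set of ground atoms. -/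
abbrev Interp (σ : Signature.{u, v}) := Set (GroundAtom σ)

/-- A ground atom as a first-order sentence. -/
def GroundAtom.toSentence (p : GroundAtom σ) : Sentence σ :=
  .atom p.pred fun i => .const (p.args i)

def Term.eval {n : ℕ} (e : Fin n → σ.Const) : Term σ n → σ.Const
  | .const c => c
  | .var i => e i

/-- Satisfaction of a formula in the MKNF structure `(I, M, N)`, the free variables being replaced
by the constants that `e` assigns to them. -/
def Formula.Sat : {n : ℕ} → Formula σ n → (Fin n → σ.Const) →
    Interp σ → Set (Interp σ) → Set (Interp σ) → Prop
  | _, .atom P t, e, I, _, _ => (⟨P, fun i => (t i).eval e⟩ : GroundAtom σ) ∈ I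
  | _, .neg φ, e, I, M, N => ¬ φ.Sat e I M N
  | _, .conj φ ψ, e, I, M, N => φ.Sat e I M N ∧ ψ.Sat e I M N
  | _, .ex φ, e, I, M, N => ∃ c : σ.Const, φ.Sat (Fin.snoc e c) I M N
  | _, .know φ, e, _, M, N => ∀ J ∈ M, φ.Sat e J M N
  | _, .naf φ, e, _, M, N => ∃ J ∈ N, ¬ φ.Sat e J M N

/-- `M ⊨ T` for a set of interpretations `M` (possibly empty) and a set of sentences `T`. -/
def Models (M : Set (Interp σ)) (T : Set (Sentence σ)) : Prop :=
  ∀ φ ∈ T, ∀ I ∈ M, φ.Sat Fin.elim0 I M M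

/-- The greatest set of interpretations `M` with `M ⊨ T`. It is only used for first-order
theories `T`, where the union below is itself such a set: see `isGreatest_mod`. -/
def mod (T : Set (Sentence σ)) : Set (Interp σ) := ⋃₀ {M | Models M T}

theorem Formula.IsFirstOrder.sat_iff {n : ℕ} {φ : Formula σ n} (h : φ.IsFirstOrder)
    (e : Fin n → σ.Const) (I : Interp σ) (M N M' N' : Set (Interp σ)) :
    φ.Sat e I M N ↔ φ.Sat e I M' N' := by
  induction φ with
  | atom P t => exact Iff.rfl
  | neg φ ih => exact not_congr (ih h e)
  | conj φ ψ ih₁ ih₂ => exact and_congr (ih₁ h.1 e) (ih₂ h.2 e)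
  | ex φ ih => exact exists_congr fun c => ih h (Fin.snoc e c)
  | know φ ih => exact h.elim
  | naf φ ih => exact h.elim

theorem isGreatest_mod {T : Set (Sentence σ)} (hT : ∀ φ ∈ T, φ.IsFirstOrder) :
    IsGreatest {M | Models M T} (mod T) := by
  refine ⟨?_, fun M hM => Set.subset_sUnion_of_mem hM⟩
  rintro φ hφ I ⟨M, hM, hI⟩
  exact ((hT φ hφ).sat_iff _ I M M _ _).1 (hM φ hφ I hI)

/-! ### Rules, ontologies and hybrid knowledge bases -/

/-- Literals: ground atoms and default literals. -/
inductive Literal (σ : Signature.{u, v})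
  | pos (p : GroundAtom σ) : Literal σ
  | dneg (p : GroundAtom σ) : Literal σ

/-- Default negation of a literal; double default negation is absorbed. -/
def Literal.compl : Literal σ → Literal σ
  | .pos p => .dneg p
  | .dneg p => .pos p

def Literal.preds : Literal σ → Set σ.Pred
  | .pos p => {p.pred}
  | .dneg p => {p.pred}

/-- The MKNF translation `π(L)` of a literal. -/
def Literal.toMKNF : Literal σ → Sentence σ
  | .pos p => .know p.toSentence
  | .dneg p => .naf p.toSentence

/-- Satisfaction of a literal in a Herbrand interpretation. -/
def Literal.Holds (I : Interp σ) : Literal σ → Prop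
  | .pos p => p ∈ I
  | .dneg p => p ∉ I

/-- A ground rule `L₀ ← L₁, …, L_k`. -/
structure Rule (σ : Signature.{u, v}) where
  head : Literal σ
  body : Finset (Literal σ)

def Rule.bodyPreds (r : Rule σ) : Set σ.Pred := ⋃ L ∈ r.body, L.preds

def Rule.preds (r : Rule σ) : Set σ.Pred := r.head.preds ∪ r.bodyPreds

def Rule.IsPositive (r : Rule σ) : Prop := ∃ p, r.head = .pos p

def Rule.IsFact (r : Rule σ) : Prop := r.body = ∅

def Rule.BodyHolds (I : Interp σ) (r : Rule σ) : Prop := ∀ L ∈ r.body, L.Holds I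

/-- A description logic: a type of ontology axioms with a translation of them into function-free
first-order sentences. -/
structure DescriptionLogic (σ : Signature.{u, v}) where
  Ax : Type w
  fo : Ax → FOSentence σ

variable {L : DescriptionLogic.{u, v, w} σ}

def DescriptionLogic.preds (L : DescriptionLogic.{u, v, w} σ) (a : L.Ax) : Set σ.Pred :=
  (L.fo a).1.preds

/-- A hybrid knowledge base: an ontology and a generalised logic program. -/
structure HybridKB (L : DescriptionLogic.{u, v, w} σ) where
  ont : Set L.Ax
  prog : Set (Rule σ)

/-- A dynamic hybrid knowledge base of length `n`. -/
abbrev DynamicKB (L : DescriptionLogic.{u, v, w} σ) (n : ℕ) := Fin n → HybridKB L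

/-! ### Minimal change update semantics -/

/-- The ground atoms of `I` with predicate symbol `P`. -/
def restrPred (P : σ.Pred) (I : Interp σ) : Set (GroundAtom σ) := {p ∈ I | p.pred = P}

/-- Difference in the interpretation of `P` between `I` and `J`. -/
def diff (P : σ.Pred) (I J : Interp σ) : Set (GroundAtom σ) :=
  (restrPred P I \ restrPred P J) ∪ (restrPred P J \ restrPred P I)

/-- `J` is at least as close to `I` as `J'`. -/
def CloserEq (I J J' : Interp σ) : Prop := ∀ P : σ.Pred, diff P I J ⊆ diff P I J'

/-- `J` is closer to `I` than `J'`. -/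
def Closer (I J J' : Interp σ) : Prop := CloserEq I J J' ∧ ¬ CloserEq I J' J

/-- `I ⊕ N`. -/
def updateOne (I : Interp σ) (N : Set (Interp σ)) : Set (Interp σ) :=
  {J ∈ N | ¬ ∃ J' ∈ N, Closer I J' J}

/-- `M ⊕ N`. -/
def update (M N : Set (Interp σ)) : Set (Interp σ) := ⋃ I ∈ M, updateOne I N

/-- `(⋯((𝓘 ⊕ M₀) ⊕ M₁) ⊕ ⋯) ⊕ M_{n-1}`, which is the set `𝓘` of all interpretations for `n = 0`. -/
def updateSeq : (n : ℕ) → (Fin n → Set (Interp σ)) → Set (Interp σ)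
  | 0, _ => Set.univ
  | n + 1, M => update (updateSeq n fun i => M i.castSucc) (M (Fin.last n))

/-- `M` is the minimal change update model of the sequence `T` of first-order theories. -/
def IsMinimalChangeModel {n : ℕ} (T : Fin n → Set (Sentence σ)) (M : Set (Interp σ)) : Prop :=
  M.Nonempty ∧ M = updateSeq n fun i => mod (T i)

/-! ### Dynamic stable models -/

/-- The least model of a program whose default literals are read as fresh atoms. -/
def least (Q : Set (Rule σ)) : Set (Literal σ) :=
  ⋂₀ {S | ∀ r ∈ Q, (∀ K ∈ r.body, K ∈ S) → r.head ∈ S}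

/-- The rules left after causal rejection. Rejection concerns occurrences of rules: the occurrence
of `r` in the `i`-th program is rejected by a conflicting rule with true body in the `j`-th
program, `i ≤ j`. -/
def unrejected {n : ℕ} (Q : Fin n → Set (Rule σ)) (I : Interp σ) : Set (Rule σ) :=
  {r | ∃ i, r ∈ Q i ∧
    ¬ ∃ j, i ≤ j ∧ ∃ r' ∈ Q j, r.head = r'.head.compl ∧ r'.BodyHolds I}

/-- The default assumptions, as facts. -/
def defaults {n : ℕ} (Q : Fin n → Set (Rule σ)) (I : Interp σ) : Set (Rule σ) :=
  {r | ∃ p : GroundAtom σ, r = ⟨.dneg p, ∅⟩ ∧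
    ¬ ∃ i, ∃ r' ∈ Q i, r'.head = .pos p ∧ r'.BodyHolds I}

/-- `I` is a dynamic stable model of the dynamic logic program `Q`. -/
def IsDynamicStableModel {n : ℕ} (Q : Fin n → Set (Rule σ)) (I : Interp σ) : Prop :=
  {K : Literal σ | K.Holds I} = least (unrejected Q I ∪ defaults Q I)

/-! ### Dynamic MKNF models of basic dynamic hybrid knowledge bases -/

namespace DynamicKB

variable {n : ℕ}

/-- All programs contain only positive facts. -/
def IsOntBased (kb : DynamicKB L n) : Prop := ∀ i, ∀ r ∈ (kb i).prog, r.IsPositive ∧ r.IsFact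

/-- All ontologies are empty. -/
def IsProgBased (kb : DynamicKB L n) : Prop := ∀ i, (kb i).ont = ∅

/-- The `i`-th first-order theory of an ontology-based dynamic knowledge base: the translated
ontology axioms together with the positive facts, read as ground atoms. -/
def theory (kb : DynamicKB L n) (i : Fin n) : Set (Sentence σ) :=
  {φ | ∃ a ∈ (kb i).ont, φ = (L.fo a).1} ∪
    {φ | ∃ p : GroundAtom σ, (⟨.pos p, ∅⟩ : Rule σ) ∈ (kb i).prog ∧ φ = p.toSentence}

/-- `M` is a dynamic MKNF model of a basic dynamic hybrid knowledge base. -/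
def IsBasicModel (kb : DynamicKB L n) (M : Set (Interp σ)) : Prop :=
  M.Nonempty ∧
    ((kb.IsOntBased ∧ IsMinimalChangeModel kb.theory M) ∨
      (kb.IsProgBased ∧
        ∃ I, IsDynamicStableModel (fun i => (kb i).prog) I ∧ M = {J | I ⊆ J}))

end DynamicKB

/-! ### Splitting sets and reducts -/

namespace HybridKB

/-- `U` is a splitting set for `kb`. -/
def IsSplittingSet (kb : HybridKB L) (U : Set σ.Pred) : Prop :=
  (∀ a ∈ kb.ont, (L.preds a ∩ U).Nonempty → L.preds a ⊆ U) ∧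
    ∀ r ∈ kb.prog, (r.head.preds ∩ U).Nonempty → r.preds ⊆ U

/-- The bottom `b_U(kb)`. -/
def bottom (U : Set σ.Pred) (kb : HybridKB L) : HybridKB L where
  ont := {a ∈ kb.ont | L.preds a ⊆ U}
  prog := {r ∈ kb.prog | r.preds ⊆ U}

/-- The top `t_U(kb)`. -/
def top (U : Set σ.Pred) (kb : HybridKB L) : HybridKB L where
  ont := kb.ont \ (kb.bottom U).ont
  prog := kb.prog \ (kb.bottom U).prog

/-- The splitting set reduct `e_U(kb, X)`. -/
def reduct (U : Set σ.Pred) (kb : HybridKB L) (X : Set (Interp σ)) : HybridKB L where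
  ont := (kb.top U).ont
  prog := {r' | ∃ r ∈ (kb.top U).prog,
    Models X (Literal.toMKNF '' {K | K ∈ r.body ∧ K.preds ⊆ U}) ∧
    r'.head = r.head ∧ ∀ K, K ∈ r'.body ↔ K ∈ r.body ∧ K.preds ⊆ Uᶜ}

end HybridKB

/-- A transfinite sequence `⟨U_α⟩_{α < μ}` of sets of predicate symbols with `μ = length`; the
values `set α` for `α ≥ μ` are irrelevant. -/
structure PredSeq (σ : Signature.{u, v}) where
  length : Ordinal.{o}
  set : Ordinal.{o} → Set σ.Pred

/-- `U` is a splitting sequence for `kb`: a monotone, continuous sequence of splitting sets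
whose union is the set of all predicate symbols. -/
structure HybridKB.IsSplittingSequence (kb : HybridKB L) (U : PredSeq.{u, v, o} σ) : Prop where
  monotone : ∀ α β, α ≤ β → β < U.length → U.set α ⊆ U.set β
  continuous : ∀ α < U.length, Order.IsSuccLimit α → U.set α = ⋃ η < α, U.set η
  splitting : ∀ α < U.length, kb.IsSplittingSet (U.set α)
  union : ⋃ α < U.length, U.set α = Set.univ

/-! ### Updatable dynamic hybrid knowledge bases -/

namespace DynamicKB

variable {n : ℕ}

def bottom (U : Set σ.Pred) (kb : DynamicKB L n) : DynamicKB L n := fun i => (kb i).bottom U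

def top (U : Set σ.Pred) (kb : DynamicKB L n) : DynamicKB L n := fun i => (kb i).top U

def reduct (U : Set σ.Pred) (kb : DynamicKB L n) (X : Set (Interp σ)) : DynamicKB L n :=
  fun i => (kb i).reduct U X

def IsSplittingSequence (kb : DynamicKB L n) (U : PredSeq.{u, v, o} σ) : Prop :=
  ∀ i, (kb i).IsSplittingSequence U

def IsOntReducible (kb : DynamicKB L n) (U : Set σ.Pred) : Prop :=
  ∀ i, ∀ r ∈ (kb i).prog, r.IsPositive ∧ r.bodyPreds ⊆ U

def IsProgReducible (kb : DynamicKB L n) : Prop := ∀ i, (kb i).ont = ∅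

def IsReducible (kb : DynamicKB L n) (U : Set σ.Pred) : Prop :=
  kb.IsOntReducible U ∨ kb.IsProgReducible

/-- `U` is an update-enabling splitting sequence for `kb`. -/
structure IsUpdateEnabling (kb : DynamicKB L n) (U : PredSeq.{u, v, o} σ) : Prop where
  splitting : kb.IsSplittingSequence U
  zero : 0 < U.length → (kb.bottom (U.set 0)).IsReducible ∅
  succ : ∀ α, Order.succ α < U.length →
    ((kb.bottom (U.set (Order.succ α))).top (U.set α)).IsReducible (U.set α)

/-- `⟨X_α⟩_{α < μ}` is a solution to `kb` with respect to `U = ⟨U_α⟩_{α < μ}`. -/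
structure IsSolution (kb : DynamicKB L n) (U : PredSeq.{u, v, o} σ)
    (X : Ordinal.{o} → Set (Interp σ)) : Prop where
  nonempty : ∀ α < U.length, (X α).Nonempty
  zero : 0 < U.length → (kb.bottom (U.set 0)).IsBasicModel (X 0)
  succ : ∀ α, Order.succ α < U.length →
    ((kb.bottom (U.set (Order.succ α))).reduct (U.set α) (⋂ η ≤ α, X η)).IsBasicModel
      (X (Order.succ α))
  limit : ∀ α < U.length, Order.IsSuccLimit α → X α = Set.univ

/-- `M` is a dynamic MKNF model of `kb` with respect to `U`. -/
def IsDynamicModelWrt (kb : DynamicKB L n) (U : PredSeq.{u, v, o} σ)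
    (M : Set (Interp σ)) : Prop :=
  M.Nonempty ∧ ∃ X, kb.IsSolution U X ∧ M = ⋂ α < U.length, X α

/-- `M` is a dynamic MKNF model of the updatable dynamic hybrid knowledge base `kb`:
a dynamic MKNF model with respect to some update-enabling splitting sequence. -/
def IsDynamicModel (kb : DynamicKB L n) (M : Set (Interp σ)) : Prop :=
  ∃ U : PredSeq.{u, v, o} σ, kb.IsUpdateEnabling U ∧ kb.IsDynamicModelWrt U M

end DynamicKB

end HybridMKNF

namespace HybridMKNF

/-!
Rank each predicate symbol by the least index at which it enters `U`. A set `M` is a dynamic model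
with respect to `U` if and only if it is the product of its projections to the layers of this
ranking, and each projection is a model of its layer, in which body literals from outside of the
layer are evaluated in `⋂₀ M`. A basic layer that is itself ranked has the same models as its finer
layers have jointly: minimal change updates minimise the difference separately for each predicate
symbol, and the least model that defines dynamic stable models can be computed along the ranking.
Hence being a model with respect to `U` and being one with respect to `V` both amount to being a
model with respect to the common refinement of the two rankings.
-/

variable {σ : Signature.{u, v}} {L : DescriptionLogic.{u, v, w} σ} {n : ℕ}

open Function Order Set
open scoped symmDiff

/-! ### Cylinders of interpretations -/

section Cylinders

variable {C D : Set σ.Pred} {I J K : Interp σ} {M X A : Set (Interp σ)}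

/-- The part of an interpretation that concerns the predicate symbols in `C`. -/
def restrict (C : Set σ.Pred) (I : Interp σ) : Interp σ := {p ∈ I | p.pred ∈ C}

/-- Two interpretations agree on `C` if they contain the same ground atoms with predicate symbol
in `C`. -/
def AgreeOn (C : Set σ.Pred) (I J : Interp σ) : Prop :=
  ∀ p : GroundAtom σ, p.pred ∈ C → (p ∈ I ↔ p ∈ J)

/-- The interpretation that is `I` on the predicate symbols in `C` and `J` elsewhere. -/
def glue (C : Set σ.Pred) (I J : Interp σ) : Interp σ := Set.ite (GroundAtom.pred ⁻¹' C) I J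

/-- A set of interpretations is a cylinder over `C` if membership in it depends only on the ground
atoms with predicate symbol in `C`. -/
def IsCyl (C : Set σ.Pred) (A : Set (Interp σ)) : Prop := ∀ ⦃I J⦄, AgreeOn C I J → I ∈ A → J ∈ A

/-- The least cylinder over `C` that contains `M`. It stands for the projection of `M` to the
predicate symbols in `C`. -/
def cyl (C : Set σ.Pred) (M : Set (Interp σ)) : Set (Interp σ) := {J | ∃ I ∈ M, AgreeOn C I J}

theorem AgreeOn.refl (C : Set σ.Pred) (I : Interp σ) : AgreeOn C I I := fun _ _ => Iff.rfl

theorem AgreeOn.symm (h : AgreeOn C I J) : AgreeOn C J I := fun p hp => (h p hp).symm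

theorem AgreeOn.trans (h : AgreeOn C I J) (h' : AgreeOn C J K) : AgreeOn C I K :=
  fun p hp => (h p hp).trans (h' p hp)

theorem AgreeOn.mono (hCD : C ⊆ D) (h : AgreeOn D I J) : AgreeOn C I J :=
  fun p hp => h p (hCD hp)

theorem agreeOn_iff_restrict_eq : AgreeOn C I J ↔ restrict C I = restrict C J := by
  simp only [AgreeOn, restrict, Set.ext_iff, mem_ofPred_eq, and_congr_left_iff]

theorem agreeOn_glue (C : Set σ.Pred) (I J : Interp σ) : AgreeOn C (glue C I J) I :=
  fun _ hp => ⟨fun h => h.elim And.left fun h => (h.2 hp).elim, fun h => .inl ⟨h, hp⟩⟩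

theorem agreeOn_compl_glue (C : Set σ.Pred) (I J : Interp σ) : AgreeOn Cᶜ (glue C I J) J :=
  fun _ hp => ⟨fun h => h.elim (fun h => (hp h.2).elim) And.left, fun h => .inr ⟨h, hp⟩⟩

theorem exists_forall_agreeOn {ι : Type*} {C : ι → Set σ.Pred} (hC : Pairwise (Disjoint on C))
    (I : ι → Interp σ) : ∃ J, ∀ i, AgreeOn (C i) (I i) J := by
  refine ⟨{p | ∃ i, p.pred ∈ C i ∧ p ∈ I i}, fun i p hp => ⟨fun h => ⟨i, hp, h⟩, ?_⟩⟩
  rintro ⟨j, hpj, h⟩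
  rwa [hC.eq (Set.not_disjoint_iff.2 ⟨p.pred, hp, hpj⟩)]

theorem IsCyl.mono (hCD : C ⊆ D) (hA : IsCyl C A) : IsCyl D A :=
  fun _ _ h => hA (h.mono hCD)

theorem IsCyl.iInter {ι : Sort*} {A : ι → Set (Interp σ)} (hA : ∀ i, IsCyl C (A i)) :
    IsCyl C (⋂ i, A i) :=
  fun _ _ h hI => mem_iInter.2 fun i => hA i h (mem_iInter.1 hI i)

theorem isCyl_cyl (C : Set σ.Pred) (M : Set (Interp σ)) : IsCyl C (cyl C M) :=
  fun _ _ h ⟨K, hK, hKI⟩ => ⟨K, hK, hKI.trans h⟩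

theorem subset_cyl (C : Set σ.Pred) (M : Set (Interp σ)) : M ⊆ cyl C M :=
  fun I hI => ⟨I, hI, .refl C I⟩

theorem cyl_empty (hM : M.Nonempty) : cyl ∅ M = univ :=
  eq_univ_of_forall fun _ => hM.imp fun _ hI => ⟨hI, fun _ h => h.elim⟩

theorem cyl_univ (M : Set (Interp σ)) : cyl univ M = M :=
  (subset_cyl _ _).antisymm' fun _ ⟨_, hI, h⟩ => Set.ext (fun p => h p trivial) ▸ hI

theorem cyl_cyl (hCD : C ⊆ D) (M : Set (Interp σ)) : cyl C (cyl D M) = cyl C M := by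
  refine Subset.antisymm ?_ fun J ⟨I, hI, h⟩ => ⟨I, subset_cyl D M hI, h⟩
  rintro J ⟨I, ⟨K, hK, hKI⟩, hIJ⟩
  exact ⟨K, hK, (hKI.mono hCD).trans hIJ⟩

theorem cyl_iInter {ι : Type*} {C : ι → Set σ.Pred} (hC : Pairwise (Disjoint on C))
    {A : ι → Set (Interp σ)} (hA : ∀ i, IsCyl (C i) (A i)) (hne : (⋂ i, A i).Nonempty) (i : ι) :
    cyl (C i) (⋂ i, A i) = A i := by
  refine Subset.antisymm (fun J ⟨I, hI, h⟩ => hA i h (mem_iInter.1 hI i)) fun J hJ => ?_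
  obtain ⟨K, hK⟩ := hne
  refine ⟨glue (C i) J K, mem_iInter.2 fun j => ?_, agreeOn_glue _ _ _⟩
  obtain rfl | hij := eq_or_ne i j
  · exact hA i (agreeOn_glue _ _ _).symm hJ
  · exact hA j ((agreeOn_compl_glue _ _ _).mono (hC hij).subset_compl_left).symm
      (mem_iInter.1 hK j)

theorem cyl_eq_iInter_iff {ι : Type*} {C : ι → Set σ.Pred} (hC : Pairwise (Disjoint on C))
    (hCD : ∀ i, C i ⊆ D) {A : ι → Set (Interp σ)} (hA : ∀ i, IsCyl (C i) (A i))
    (hM : M.Nonempty) :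
    cyl D M = ⋂ i, A i ↔ cyl D M = ⋂ i, cyl (C i) M ∧ ∀ i, cyl (C i) M = A i := by
  refine ⟨fun h => ?_, fun ⟨h, hMA⟩ => h.trans (iInter_congr hMA)⟩
  have hMA (i) : cyl (C i) M = A i := by
    rw [← cyl_cyl (hCD i), h, cyl_iInter hC hA (h ▸ hM.mono (subset_cyl D M))]
  exact ⟨h.trans (iInter_congr hMA).symm, hMA⟩

theorem eq_iInter_iff {ι : Type*} {C : ι → Set σ.Pred} (hC : Pairwise (Disjoint on C))
    {A : ι → Set (Interp σ)} (hA : ∀ i, IsCyl (C i) (A i)) (hM : M.Nonempty) :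
    M = ⋂ i, A i ↔ M = ⋂ i, cyl (C i) M ∧ ∀ i, cyl (C i) M = A i := by
  simpa only [cyl_univ] using cyl_eq_iInter_iff hC (fun i => subset_univ (C i)) hA hM

theorem agreeOn_sInter (hMX : M ⊆ X) (hX : X ⊆ cyl C M) : AgreeOn C (⋂₀ X) (⋂₀ M) := by
  refine fun p hp => ⟨fun h I hI => h I (hMX hI), fun h J hJ => ?_⟩
  obtain ⟨I, hI, hIJ⟩ := hX hJ
  exact (hIJ p hp).1 (h I hI)

theorem sInter_cyl (hM : M.Nonempty) : ⋂₀ cyl C M = restrict C (⋂₀ M) := by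
  have h : AgreeOn C (⋂₀ cyl C M) (⋂₀ M) := agreeOn_sInter (subset_cyl C M) Subset.rfl
  refine Subset.antisymm (fun p hp => ?_) fun p hp => (h p hp.2).2 hp.1
  have hpC : p.pred ∈ C := by
    obtain ⟨I, hI⟩ := hM
    by_contra hpC
    exact absurd (hp (I \ {p}) ⟨I, hI, fun q hq => ⟨fun h => ⟨h, fun hqp => hpC (hqp ▸ hq)⟩,
      And.left⟩⟩) fun h => h.2 rfl
  exact ⟨(h p hpC).1 hp, hpC⟩

theorem isCyl_Ici_restrict (C : Set σ.Pred) (I : Interp σ) : IsCyl C (Ici (restrict C I)) :=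
  fun _ _ h hI p hp => (h p hp.2).1 (hI hp)

end Cylinders

/-! ### First-order theories -/

section FirstOrder

variable {C : Set σ.Pred} {I J : Interp σ}

theorem Formula.preds_nonempty (φ : Formula σ n) : φ.preds.Nonempty := by
  induction φ with
  | atom P _ => exact ⟨P, rfl⟩
  | conj _ _ ih _ => exact ih.mono subset_union_left
  | neg _ ih | ex _ ih | know _ ih | naf _ ih => exact ih

theorem Formula.IsFirstOrder.sat_congr {φ : Formula σ n} (h : φ.IsFirstOrder)
    (hIJ : AgreeOn φ.preds I J) (e : Fin n → σ.Const) (M N : Set (Interp σ)) :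
    φ.Sat e I M N ↔ φ.Sat e J M N := by
  induction φ with
  | atom _ _ => exact hIJ _ rfl
  | neg _ ih => exact not_congr (ih h hIJ e)
  | conj _ _ ih₁ ih₂ =>
    exact and_congr (ih₁ h.1 (hIJ.mono subset_union_left) e)
      (ih₂ h.2 (hIJ.mono subset_union_right) e)
  | ex _ ih => exact exists_congr fun c => ih h hIJ (Fin.snoc e c)
  | know _ _ | naf _ _ => exact h.elim

theorem mem_mod_iff {T : Set (Sentence σ)} (hT : ∀ φ ∈ T, φ.IsFirstOrder) :
    I ∈ mod T ↔ ∀ φ ∈ T, φ.Sat Fin.elim0 I ∅ ∅ := by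
  have hsat {J : Interp σ} {M : Set (Interp σ)} {φ} (hφ : φ ∈ T) :
      φ.Sat Fin.elim0 J M M ↔ φ.Sat Fin.elim0 J ∅ ∅ := (hT φ hφ).sat_iff _ _ _ _ _ _
  refine ⟨fun hI φ hφ => (hsat hφ).1 ((isGreatest_mod hT).1 φ hφ I hI), fun h => ?_⟩
  have hI : Models {I} T := by
    rintro φ hφ _ rfl
    exact (hsat hφ).2 (h φ hφ)
  exact (isGreatest_mod hT).2 hI rfl

theorem isCyl_mod {T : Set (Sentence σ)} (hT : ∀ φ ∈ T, φ.IsFirstOrder)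
    (hC : ∀ φ ∈ T, φ.preds ⊆ C) : IsCyl C (mod T) := by
  intro I J hIJ hI
  rw [mem_mod_iff hT] at hI ⊢
  exact fun φ hφ => ((hT φ hφ).sat_congr (hIJ.mono (hC φ hφ)) _ _ _).1 (hI φ hφ)

theorem mod_iUnion {ι : Sort*} {T : ι → Set (Sentence σ)}
    (hT : ∀ i, ∀ φ ∈ T i, φ.IsFirstOrder) : mod (⋃ i, T i) = ⋂ i, mod (T i) := by
  have hT' : ∀ φ ∈ ⋃ i, T i, φ.IsFirstOrder := fun φ hφ =>
    have ⟨i, hi⟩ := mem_iUnion.1 hφ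
    hT i φ hi
  ext I
  simp only [mem_mod_iff hT', mem_iInter, mem_mod_iff (hT _), mem_iUnion]
  exact ⟨fun h i φ hφ => h φ ⟨i, hφ⟩, fun h φ ⟨i, hφ⟩ => h i φ hφ⟩

end FirstOrder

/-! ### Minimal change updates -/

section Update

variable {C : Set σ.Pred} {I I' J J' : Interp σ} {M N : Set (Interp σ)}

theorem closerEq_iff : CloserEq I J J' ↔ I ∆ J ⊆ I ∆ J' := by
  have hdiff (P : σ.Pred) (K : Interp σ) : diff P I K = {p ∈ I ∆ K | p.pred = P} := by
    ext p
    simp only [diff, restrPred, mem_union, mem_sdiff, mem_symmDiff, mem_ofPred_eq]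
    tauto
  simp only [CloserEq, hdiff]
  exact ⟨fun h p hp => (h p.pred ⟨hp, rfl⟩).1, fun h P p hp => ⟨h hp.1, hp.2⟩⟩

theorem mem_update_iff : J ∈ update M N ↔ ∃ I ∈ M, MinimalFor (· ∈ N) (I ∆ ·) J := by
  simp only [update, updateOne, Closer, closerEq_iff, mem_iUnion, mem_ofPred_eq, MinimalFor,
    exists_prop, not_exists, not_and, not_not]

/-- Among the elements of `N`, the interpretation `J` has a minimal difference from `I` on the
predicate symbols in `C`. -/
def IsClosestOn (C : Set σ.Pred) (N : Set (Interp σ)) (I J : Interp σ) : Prop :=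
  MinimalFor (· ∈ N) (fun K => restrict C (I ∆ K)) J

theorem restrict_symmDiff_congr (hI : AgreeOn C I I') (hJ : AgreeOn C J J') :
    restrict C (I ∆ J) = restrict C (I' ∆ J') :=
  agreeOn_iff_restrict_eq.1 fun p hp => by simp only [mem_symmDiff, hI p hp, hJ p hp]

theorem symmDiff_glue (C : Set σ.Pred) (I K : Interp σ) :
    I ∆ glue C K I = restrict C (I ∆ K) := by
  ext p
  by_cases hp : p.pred ∈ C
  · simp [restrict, mem_symmDiff, agreeOn_glue C K I p hp, hp]
  · simp [restrict, mem_symmDiff, agreeOn_compl_glue C K I p hp, hp]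

theorem IsClosestOn.congr (hN : IsCyl C N) (hI : AgreeOn C I I') (hJ : AgreeOn C J J')
    (h : IsClosestOn C N I J) : IsClosestOn C N I' J' := by
  refine ⟨hN hJ h.prop, fun K hK hle => ?_⟩
  have hle' := h.le_of_le hK
  simp only [restrict_symmDiff_congr hI hJ, restrict_symmDiff_congr hI (.refl C K)] at hle'
  exact hle' hle

theorem minimalFor_symmDiff_iff (hN : IsCyl C N) :
    MinimalFor (· ∈ N) (I ∆ ·) J ↔ AgreeOn Cᶜ I J ∧ IsClosestOn C N I J := by
  constructor
  · intro h
    have hle {K : Interp σ} (hK : K ∈ N) (hKJ : restrict C (I ∆ K) ⊆ restrict C (I ∆ J)) :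
        I ∆ J ⊆ restrict C (I ∆ K) := by
      rw [← symmDiff_glue] at hKJ ⊢
      exact h.le_of_le (hN (agreeOn_glue C K I).symm hK) (hKJ.trans fun _ hp => hp.1)
    refine ⟨fun p hp => ?_, h.prop, fun K hK hKJ p hp => hle hK hKJ hp.1⟩
    by_contra hpIJ
    exact hp (hle h.prop Subset.rfl (by rw [mem_symmDiff]; tauto)).2
  · rintro ⟨hIJ, hJ⟩
    refine ⟨hJ.prop, fun K hK hle p hp => ?_⟩
    have hpC : p.pred ∈ C := by
      by_contra hpC
      rw [mem_symmDiff, hIJ p hpC] at hp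
      tauto
    exact (hJ.le_of_le hK (fun q hq => ⟨hle hq.1, hq.2⟩) ⟨hp, hpC⟩).1

theorem mem_update_iff_of_isCyl (hM : IsCyl C M) (hN : IsCyl C N) :
    J ∈ update M N ↔ ∃ I ∈ M, IsClosestOn C N I J := by
  simp only [mem_update_iff, minimalFor_symmDiff_iff hN]
  refine ⟨fun ⟨I, hI, h⟩ => ⟨I, hI, h.2⟩, fun ⟨I, hI, h⟩ => ?_⟩
  have hglue : AgreeOn C I (glue C I J) := (agreeOn_glue C I J).symm
  exact ⟨glue C I J, hM hglue hI, agreeOn_compl_glue C I J, h.congr hN hglue (.refl C J)⟩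

theorem IsCyl.update (hM : IsCyl C M) (hN : IsCyl C N) : IsCyl C (update M N) := by
  intro J J' hJ
  simp only [mem_update_iff_of_isCyl hM hN]
  exact fun ⟨I, hI, h⟩ => ⟨I, hI, h.congr hN (.refl C I) hJ⟩

theorem isCyl_updateSeq {N : Fin n → Set (Interp σ)} (hN : ∀ i, IsCyl C (N i)) :
    IsCyl C (updateSeq n N) := by
  induction n with
  | zero => exact fun _ _ _ _ => trivial
  | succ n ih => exact (ih fun i => hN i.castSucc).update (hN _)

section Product

variable {ι : Type*} {C : ι → Set σ.Pred} (hC : Pairwise (Disjoint on C))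

include hC

theorem isClosestOn_iUnion_iInter_iff {N : ι → Set (Interp σ)} (hN : ∀ i, IsCyl (C i) (N i)) :
    IsClosestOn (⋃ i, C i) (⋂ i, N i) I J ↔ ∀ i, IsClosestOn (C i) (N i) I J := by
  constructor
  · refine fun h i => ⟨mem_iInter.1 h.prop i, fun K hK hle p hp => ?_⟩
    have hon := agreeOn_glue (C i) K J
    have hoff := agreeOn_compl_glue (C i) K J
    have hmem : glue (C i) K J ∈ ⋂ j, N j := mem_iInter.2 fun j => by
      obtain rfl | hij := eq_or_ne i j
      · exact hN i hon.symm hK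
      · exact hN j (hoff.mono (hC hij).subset_compl_left).symm (mem_iInter.1 h.prop j)
    have hglue : restrict (⋃ j, C j) (I ∆ glue (C i) K J) ⊆ restrict (⋃ j, C j) (I ∆ J) := by
      rintro q ⟨hq, hqC⟩
      refine ⟨?_, hqC⟩
      by_cases hqi : q.pred ∈ C i
      · rw [mem_symmDiff, hon q hqi] at hq
        exact (hle ⟨hq, hqi⟩).1
      · rwa [mem_symmDiff, hoff q hqi] at hq
    have hpK := (h.le_of_le hmem hglue ⟨hp.1, mem_iUnion_of_mem i hp.2⟩).1
    rw [mem_symmDiff, hon p hp.2] at hpK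
    exact ⟨hpK, hp.2⟩
  · refine fun h => ⟨mem_iInter.2 fun i => (h i).prop, fun K hK hle p hp => ?_⟩
    obtain ⟨i, hi⟩ := mem_iUnion.1 hp.2
    exact ⟨((h i).le_of_le (mem_iInter.1 hK i)
      (fun q hq => ⟨(hle ⟨hq.1, mem_iUnion_of_mem i hq.2⟩).1, hq.2⟩) ⟨hp.1, hi⟩).1, hp.2⟩

theorem update_iInter {M N : ι → Set (Interp σ)} (hM : ∀ i, IsCyl (C i) (M i))
    (hN : ∀ i, IsCyl (C i) (N i)) :
    update (⋂ i, M i) (⋂ i, N i) = ⋂ i, update (M i) (N i) := by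
  have hcyl {A : ι → Set (Interp σ)} (hA : ∀ i, IsCyl (C i) (A i)) :
      IsCyl (⋃ i, C i) (⋂ i, A i) := .iInter fun i => (hA i).mono (subset_iUnion C i)
  ext J
  simp only [mem_update_iff_of_isCyl (hcyl hM) (hcyl hN), mem_iInter,
    mem_update_iff_of_isCyl (hM _) (hN _), isClosestOn_iUnion_iInter_iff hC hN]
  refine ⟨fun ⟨I, hI, h⟩ i => ⟨I, hI i, h i⟩, fun h => ?_⟩
  choose I hI hIJ using h
  obtain ⟨I', hI'⟩ := exists_forall_agreeOn hC I
  exact ⟨I', fun i => hM i (hI' i) (hI i), fun i => (hIJ i).congr (hN i) (hI' i) (.refl _ _)⟩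

theorem updateSeq_iInter {N : ι → Fin n → Set (Interp σ)} (hN : ∀ i k, IsCyl (C i) (N i k)) :
    updateSeq n (fun k => ⋂ i, N i k) = ⋂ i, updateSeq n (N i) := by
  induction n with
  | zero => exact (iInter_eq_univ.2 fun _ => rfl).symm
  | succ n ih =>
    simp only [updateSeq]
    rw [ih fun i k => hN i k.castSucc,
      update_iInter hC (fun i => isCyl_updateSeq fun k => hN i k.castSucc) fun i => hN i _]

end Product

theorem update_Ici_Ici (F G : Interp σ) : update (Ici F) (Ici G) = Ici (F ∪ G) := by
  ext J
  simp only [mem_update_iff, mem_Ici]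
  constructor
  · rintro ⟨I, hF, hmin⟩
    have hle : I ∆ J ⊆ I ∆ (I ∪ J) := hmin.le_of_le (hmin.prop.trans subset_union_right)
      (fun p hp => by simp only [mem_symmDiff, mem_union] at hp ⊢; tauto)
    have hIJ : I ⊆ J := fun p hp => by
      have := @hle p
      simp only [mem_symmDiff, mem_union] at this
      tauto
    exact union_subset (hF.trans hIJ) hmin.prop
  · intro h
    refine ⟨J, subset_union_left.trans h, subset_union_right.trans h, fun K _ _ => ?_⟩
    simp only [symmDiff_self, bot_le]

theorem updateSeq_Ici (F : Fin n → Interp σ) :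
    updateSeq n (fun i => Ici (F i)) = Ici (⋃ i, F i) := by
  induction n with
  | zero => simp [updateSeq, ← bot_eq_empty]
  | succ n ih =>
    simp only [updateSeq]
    rw [ih fun i => F i.castSucc, update_Ici_Ici]
    congr 1
    ext J
    simp only [mem_union, mem_iUnion, Fin.exists_fin_succ']

end Update

/-! ### Splitting logic programs -/

section Literals

variable {C : Set σ.Pred} {I J : Interp σ} {K : Literal σ}

/-- The predicate symbol of a literal. -/
def Literal.pred : Literal σ → σ.Pred
  | .pos p => p.pred
  | .dneg p => p.pred

/-- The set of literals that are true in an interpretation. -/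
def literals (I : Interp σ) : Set (Literal σ) := {K | K.Holds I}

theorem Literal.preds_eq (K : Literal σ) : K.preds = {K.pred} := by
  cases K <;> rfl

theorem Literal.pred_compl (K : Literal σ) : K.compl.pred = K.pred := by
  cases K <;> rfl

theorem Literal.eq_compl_comm {H : Literal σ} : H = K.compl ↔ K = H.compl := by
  cases K <;> cases H <;> simp [Literal.compl, eq_comm]

theorem Literal.holds_congr (h : AgreeOn C I J) (hK : K.pred ∈ C) : K.Holds I ↔ K.Holds J := by
  cases K with
  | pos p => exact h p hK
  | dneg p => exact not_congr (h p hK)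

theorem agreeOn_restrict (C : Set σ.Pred) (I : Interp σ) : AgreeOn C (restrict C I) I :=
  fun _ hp => and_iff_left hp

theorem literals_restrict (C : Set σ.Pred) (I : Interp σ) :
    literals (restrict C I) =
      literals I ∩ Literal.pred ⁻¹' C ∪ Literal.dneg '' {p | p.pred ∉ C} := by
  ext (p | p)
  · simp [literals, restrict, Literal.Holds, Literal.pred]
  · simp only [literals, restrict, Literal.Holds, Literal.pred, mem_union, mem_inter_iff,
      mem_image, mem_preimage, mem_ofPred_eq, Literal.dneg.injEq, exists_eq_right]
    tauto

end Literals

section Programs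

variable {C D : Set σ.Pred} {T S : Set (Literal σ)} {P P' : Set (Rule σ)} {r : Rule σ}

theorem least_subset (h : ∀ r ∈ P, (∀ K ∈ r.body, K ∈ S) → r.head ∈ S) : least P ⊆ S :=
  sInter_subset_of_mem h

theorem head_mem_least (hr : r ∈ P) (h : ∀ K ∈ r.body, K ∈ least P) : r.head ∈ least P :=
  mem_sInter.2 fun _ hS => hS r hr fun K hK => mem_sInter.1 (h K hK) _ hS

theorem least_mono (h : P ⊆ P') : least P ⊆ least P' :=
  least_subset fun _ hr hb => head_mem_least (h hr) hb

/-- The rule without body whose head is a given literal. -/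
def fact (K : Literal σ) : Rule σ := ⟨K, ∅⟩

theorem least_union_fact (hS : ∀ r ∈ P, ∀ K ∈ r.body, K ∉ S) :
    least (P ∪ fact '' S) = least P ∪ S := by
  refine Subset.antisymm (least_subset ?_) (union_subset (least_mono subset_union_left) ?_)
  · rintro r (hr | ⟨K, hK, rfl⟩) hb
    · exact .inl (head_mem_least hr fun K hK => (hb K hK).resolve_right (hS r hr K hK))
    · exact .inr hK
  · exact fun K hK => head_mem_least (r := fact K) (.inr ⟨K, hK, rfl⟩) (by simp [fact])

theorem least_fact (S : Set (Literal σ)) : least (fact '' S) = S := by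
  have hempty : least (∅ : Set (Rule σ)) = ∅ := subset_eq_empty (least_subset (by simp)) rfl
  simpa [hempty] using least_union_fact (P := ∅) (S := S) (by simp)

open Classical in
/-- The rule `r` without those body literals whose predicate symbols are not in `C`. -/
noncomputable def Rule.restrict (C : Set σ.Pred) (r : Rule σ) : Rule σ where
  head := r.head
  body := {K ∈ r.body | K.pred ∈ C}

@[simp]
theorem Rule.head_restrict : (r.restrict C).head = r.head := rfl

@[simp]
theorem Rule.mem_body_restrict {K : Literal σ} :
    K ∈ (r.restrict C).body ↔ K ∈ r.body ∧ K.pred ∈ C := by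
  simp [Rule.restrict]

/-- The rules of `P` with head in `C`, their body literals outside of `C` being evaluated in the
set `T` of literals that are taken to be true. -/
def partialEval (C : Set σ.Pred) (T : Set (Literal σ)) (P : Set (Rule σ)) : Set (Rule σ) :=
  Rule.restrict C '' {r ∈ P | r.head.pred ∈ C ∧ ∀ K ∈ r.body, K.pred ∉ C → K ∈ T}

/-- On the predicate symbols in `C`, the literals in `T` are those that `P` derives from the
literals in `T` with other predicate symbols. -/
def IsLeastOn (T : Set (Literal σ)) (P : Set (Rule σ)) (C : Set σ.Pred) : Prop :=
  T ∩ Literal.pred ⁻¹' C = least (partialEval C T P)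

theorem partialEval_union :
    partialEval C T (P ∪ P') = partialEval C T P ∪ partialEval C T P' := by
  rw [partialEval, partialEval, partialEval, ← image_union]
  congr 1
  ext r
  exact or_and_right

theorem partialEval_fact : partialEval C T (fact '' S) = fact '' (S ∩ Literal.pred ⁻¹' C) := by
  have hrestrict (K : Literal σ) : (fact K).restrict C = fact K := by simp [fact, Rule.restrict]
  ext r
  constructor
  · rintro ⟨_, ⟨⟨K, hK, rfl⟩, hC, -⟩, rfl⟩
    exact ⟨K, ⟨hK, hC⟩, (hrestrict K).symm⟩
  · rintro ⟨K, ⟨hK, hC⟩, rfl⟩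
    exact ⟨fact K, ⟨⟨K, hK, rfl⟩, hC, by simp [fact]⟩, hrestrict K⟩

theorem body_pred_mem_of_mem_partialEval (hr : r ∈ partialEval C T P) {K : Literal σ}
    (hK : K ∈ r.body) : K.pred ∈ C := by
  obtain ⟨r, -, rfl⟩ := hr
  exact (Rule.mem_body_restrict.1 hK).2

theorem head_mem_least_partialEval (hr : r ∈ P) (hC : r.head.pred ∈ C)
    (hT : ∀ K ∈ r.body, K.pred ∉ C → K ∈ T)
    (hb : ∀ K ∈ r.body, K.pred ∈ C → K ∈ least (partialEval C T P)) :
    r.head ∈ least (partialEval C T P) :=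
  head_mem_least (r := r.restrict C) ⟨r, ⟨hr, hC, hT⟩, rfl⟩ fun K hK =>
    have hK := Rule.mem_body_restrict.1 hK
    hb K hK.1 hK.2

theorem least_partialEval_subset (h : ∀ r ∈ P, r.head.pred ∈ C →
    (∀ K ∈ r.body, K.pred ∉ C → K ∈ T) → (∀ K ∈ r.body, K.pred ∈ C → K ∈ S) → r.head ∈ S) :
    least (partialEval C T P) ⊆ S := by
  refine least_subset ?_
  rintro _ ⟨r, ⟨hr, hC, hT⟩, rfl⟩ hb
  exact h r hr hC hT fun K hK hKC => hb K (Rule.mem_body_restrict.2 ⟨hK, hKC⟩)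

theorem least_partialEval_subset_preimage : least (partialEval C T P) ⊆ Literal.pred ⁻¹' C :=
  least_partialEval_subset fun _ _ hC _ _ => hC

theorem IsLeastOn.head_mem (h : IsLeastOn T P C) (hr : r ∈ P) (hC : r.head.pred ∈ C)
    (hb : ∀ K ∈ r.body, K ∈ T) : r.head ∈ T :=
  (h.superset (head_mem_least_partialEval hr hC (fun K hK _ => hb K hK) fun K hK hKC =>
    h.subset ⟨hb K hK, hKC⟩)).1

theorem least_partialEval_subset_of_head_mem
    (h : ∀ r ∈ P, r.head.pred ∈ C → (∀ K ∈ r.body, K ∈ T) → r.head ∈ T) :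
    least (partialEval C T P) ⊆ T ∩ Literal.pred ⁻¹' C :=
  subset_inter (least_partialEval_subset fun r hr hC hT hb => h r hr hC fun K hK =>
    (em (K.pred ∈ C)).elim (hb K hK) (hT K hK)) least_partialEval_subset_preimage

theorem IsLeastOn.mono (hCD : C ⊆ D) (h : IsLeastOn T P D) : IsLeastOn T P C := by
  have hsub : least (partialEval D T P) ⊆
      {K ∈ T | K.pred ∈ C → K ∈ least (partialEval C T P)} := by
    refine least_partialEval_subset fun r hr hD hT hb => ?_
    have hbT : ∀ K ∈ r.body, K ∈ T := fun K hK =>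
      (em (K.pred ∈ D)).elim (fun hKD => (hb K hK hKD).1) (hT K hK)
    exact ⟨h.head_mem hr hD hbT, fun hC => head_mem_least_partialEval hr hC
      (fun K hK _ => hbT K hK) fun K hK hKC => (hb K hK (hCD hKC)).2 hKC⟩
  refine Subset.antisymm (fun K ⟨hKT, hKC⟩ => (hsub (h.subset ⟨hKT, hCD hKC⟩)).2 hKC) ?_
  exact least_partialEval_subset_of_head_mem fun r hr hC => h.head_mem hr (hCD hC)

theorem isLeastOn_iff_forall {κ : Type*} [PartialOrder κ] [WellFoundedLT κ] {τ : σ.Pred → κ}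
    (hτ : ∀ r ∈ P, ∀ K ∈ r.body, τ K.pred ≤ τ r.head.pred) :
    IsLeastOn T P D ↔ ∀ j, IsLeastOn T P (D ∩ τ ⁻¹' {j}) := by
  refine ⟨fun h j => h.mono inter_subset_left, fun h => Subset.antisymm ?_ ?_⟩
  · suffices hind : ∀ j, ∀ K ∈ T, K.pred ∈ D → τ K.pred = j → K ∈ least (partialEval D T P) from
      fun K hK => hind _ K hK.1 hK.2 rfl
    intro j
    induction j using WellFoundedLT.induction with
    | ind j ih =>
      intro K hK hKD hKj
      refine least_partialEval_subset ?_ ((h j).subset ⟨hK, hKD, hKj⟩)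
      rintro r hr ⟨hrD, rfl⟩ hT hb
      refine head_mem_least_partialEval hr hrD (fun K hK hKD => hT K hK fun h => hKD h.1)
        fun K hK hKD => ?_
      obtain heq | hlt := (hτ r hr K hK).eq_or_lt
      · exact hb K hK ⟨hKD, heq⟩
      · exact ih _ hlt K (hT K hK fun h => hlt.ne h.2) hKD rfl
  · exact least_partialEval_subset_of_head_mem fun r hr hD =>
      (h (τ r.head.pred)).head_mem hr ⟨hD, rfl⟩

end Programs

section DynamicPrograms

variable {C : Set σ.Pred} {Q : Fin n → Set (Rule σ)} {I : Interp σ}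

/-- The program of which a dynamic stable model `I` is the least model. -/
def rulesInForce (Q : Fin n → Set (Rule σ)) (I : Interp σ) : Set (Rule σ) :=
  unrejected Q I ∪ defaults Q I

theorem exists_bodyHolds_partialEval {P : Set (Rule σ)} {H : Literal σ} (hH : H.pred ∈ C) :
    (∃ r ∈ partialEval C (literals I) P, r.head = H ∧ r.BodyHolds (restrict C I)) ↔
      ∃ r ∈ P, r.head = H ∧ r.BodyHolds I := by
  have hcongr {K : Literal σ} (hK : K.pred ∈ C) : K.Holds (restrict C I) ↔ K.Holds I :=
    K.holds_congr (agreeOn_restrict C I) hK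
  simp only [Rule.BodyHolds]
  constructor
  · rintro ⟨_, ⟨r, ⟨hr, -, hT⟩, rfl⟩, hrH, hb⟩
    refine ⟨r, hr, hrH, fun K hK => (em (K.pred ∈ C)).elim (fun hKC => ?_) (hT K hK)⟩
    exact (hcongr hKC).1 (hb K (Rule.mem_body_restrict.2 ⟨hK, hKC⟩))
  · rintro ⟨r, hr, rfl, hb⟩
    refine ⟨r.restrict C, ⟨r, ⟨hr, hH, fun K hK _ => hb K hK⟩, rfl⟩, rfl, fun K hK => ?_⟩
    rw [Rule.mem_body_restrict] at hK
    exact (hcongr hK.2).2 (hb K hK.1)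

theorem unrejected_partialEval :
    unrejected (fun i => partialEval C (literals I) (Q i)) (restrict C I) =
      partialEval C (literals I) (unrejected Q I) := by
  have hrej {H : Literal σ} (hH : H.pred ∈ C) (i) :
      (∃ r ∈ partialEval C (literals I) (Q i), H = r.head.compl ∧ r.BodyHolds (restrict C I)) ↔
        ∃ r ∈ Q i, H = r.head.compl ∧ r.BodyHolds I := by
    simp only [Literal.eq_compl_comm (H := H)]
    exact exists_bodyHolds_partialEval (H.pred_compl ▸ hH)
  ext r'
  constructor
  · rintro ⟨i, ⟨r, ⟨hr, hC, hT⟩, rfl⟩, hnot⟩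
    simp only [Rule.head_restrict, hrej hC] at hnot
    exact ⟨r, ⟨⟨i, hr, hnot⟩, hC, hT⟩, rfl⟩
  · rintro ⟨r, ⟨⟨i, hr, hnot⟩, hC, hT⟩, rfl⟩
    simp only [← hrej hC] at hnot
    exact ⟨i, ⟨r, ⟨hr, hC, hT⟩, rfl⟩, hnot⟩

theorem defaults_eq_image :
    defaults Q I = fact '' (Literal.dneg ''
      {p | ∀ i, ¬ ∃ r ∈ Q i, r.head = .pos p ∧ r.BodyHolds I}) := by
  ext r
  simp only [defaults, fact, image_image, mem_ofPred_eq, mem_image, not_exists, and_comm, eq_comm]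

theorem defaults_partialEval :
    defaults (fun i => partialEval C (literals I) (Q i)) (restrict C I) =
      partialEval C (literals I) (defaults Q I) ∪
        fact '' (Literal.dneg '' {p | p.pred ∉ C}) := by
  have hatoms : {p | ∀ i, ¬ ∃ r ∈ partialEval C (literals I) (Q i),
      r.head = .pos p ∧ r.BodyHolds (restrict C I)} =
      {p | ∀ i, ¬ ∃ r ∈ Q i, r.head = .pos p ∧ r.BodyHolds I} ∩ Literal.dneg ⁻¹'
        (Literal.pred ⁻¹' C) ∪ {p | p.pred ∉ C} := by
    ext p
    by_cases hp : p.pred ∈ C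
    · have hiff (i) := exists_bodyHolds_partialEval (I := I) (P := Q i) (H := .pos p) hp
      simp only [mem_ofPred_eq, hiff, mem_union, mem_inter_iff, mem_preimage, Literal.pred, hp,
        and_true, not_true, or_false]
    · refine iff_of_true ?_ (.inr hp)
      rintro i ⟨_, ⟨r, ⟨-, hC, -⟩, rfl⟩, hr, -⟩
      rw [← Rule.head_restrict (C := C), hr] at hC
      exact hp hC
  rw [defaults_eq_image, hatoms, image_union, image_union, image_inter_preimage,
    defaults_eq_image, partialEval_fact]

theorem isDynamicStableModel_partialEval_iff :
    IsDynamicStableModel (fun i => partialEval C (literals I) (Q i)) (restrict C I) ↔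
      IsLeastOn (literals I) (rulesInForce Q I) C := by
  have hbody : ∀ r ∈ partialEval C (literals I) (rulesInForce Q I), ∀ K ∈ r.body,
      K ∉ Literal.dneg '' {p : GroundAtom σ | p.pred ∉ C} := by
    rintro r hr _ hK ⟨p, hp, rfl⟩
    exact hp (body_pred_mem_of_mem_partialEval hr hK)
  have hleast : least (unrejected (fun i => partialEval C (literals I) (Q i)) (restrict C I) ∪
      defaults (fun i => partialEval C (literals I) (Q i)) (restrict C I)) =
      least (partialEval C (literals I) (rulesInForce Q I)) ∪
        Literal.dneg '' {p | p.pred ∉ C} := by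
    rw [unrejected_partialEval, defaults_partialEval, ← union_assoc, ← partialEval_union,
      ← rulesInForce, least_union_fact hbody]
  have hcancel {A B : Set (Literal σ)} (hA : A ⊆ Literal.pred ⁻¹' C) :
      A ⊆ B ∪ Literal.dneg '' {p | p.pred ∉ C} ↔ A ⊆ B := by
    refine ⟨fun h => Disjoint.subset_left_of_subset_union h ?_, fun h =>
      subset_union_of_subset_left h _⟩
    rw [Set.disjoint_right]
    rintro _ ⟨p, hp, rfl⟩ hpA
    exact hp (hA hpA)
  change literals (restrict C I) = _ ↔ _
  rw [hleast, literals_restrict, union_eq_union_iff_right, hcancel inter_subset_right,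
    hcancel least_partialEval_subset_preimage, IsLeastOn, Subset.antisymm_iff]

end DynamicPrograms

/-! ### Models of basic dynamic knowledge bases -/

theorem literals_eq (I : Interp σ) :
    literals I = Literal.pos '' I ∪ Literal.dneg '' Iᶜ := by
  ext (p | p) <;> simp [literals, Literal.Holds]

theorem literals_injective : Injective (literals (σ := σ)) := fun _ _ h =>
  Set.ext fun p => Set.ext_iff.1 h (.pos p)

theorem rulesInForce_fact (F : Fin n → Interp σ) (I : Interp σ) :
    rulesInForce (fun i => fact '' (Literal.pos '' F i)) I = fact '' literals (⋃ i, F i) := by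
  have hunrejected : unrejected (fun i => fact '' (Literal.pos '' F i)) I =
      fact '' (Literal.pos '' ⋃ i, F i) := by
    simp only [image_iUnion]
    ext r
    rw [mem_iUnion]
    refine ⟨fun ⟨i, hr, _⟩ => ⟨i, hr⟩, fun ⟨i, hr⟩ => ⟨i, hr, ?_⟩⟩
    rintro ⟨_, -, _, ⟨_, ⟨q, -, rfl⟩, rfl⟩, hcompl, -⟩
    obtain ⟨_, ⟨p, -, rfl⟩, rfl⟩ := hr
    cases hcompl
  have hdefaults : defaults (fun i => fact '' (Literal.pos '' F i)) I =
      fact '' (Literal.dneg '' (⋃ i, F i)ᶜ) := by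
    rw [defaults_eq_image]
    congr 2
    ext p
    simp [fact, Rule.BodyHolds]
  rw [rulesInForce, hunrejected, hdefaults, literals_eq, image_union]

theorem IsDynamicStableModel.isCyl_Ici {Q : Fin n → Set (Rule σ)} {I : Interp σ}
    (h : IsDynamicStableModel Q I) {C : Set σ.Pred}
    (hC : ∀ i, ∀ r ∈ Q i, r.head.pred ∈ C) : IsCyl C (Ici I) := by
  have hsub : literals I ⊆ {K | ∀ p, K = .pos p → p.pred ∈ C} := by
    refine h.subset.trans (least_subset ?_)
    rintro r (⟨i, hr, -⟩ | ⟨q, rfl, -⟩) - p hp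
    · have hhead := hC i r hr
      rwa [hp] at hhead
    · cases hp
  exact fun J K hJK hJ p hp => (hJK p (hsub (show .pos p ∈ literals I from hp) p rfl)).1 (hJ hp)

namespace DynamicKB

variable {kb : DynamicKB L n} {M : Set (Interp σ)}

/-- The ground atoms that are facts of the `i`-th program. -/
def facts (kb : DynamicKB L n) (i : Fin n) : Interp σ := {p | fact (.pos p) ∈ (kb i).prog}

theorem isFirstOrder_of_mem_theory {i : Fin n} : ∀ φ ∈ kb.theory i, φ.IsFirstOrder := by
  rintro _ (⟨a, -, rfl⟩ | ⟨p, -, rfl⟩)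
  · exact (L.fo a).2
  · trivial

theorem isCyl_mod_theory {i : Fin n} {C : Set σ.Pred} (hont : ∀ a ∈ (kb i).ont, L.preds a ⊆ C)
    (hprog : ∀ r ∈ (kb i).prog, r.head.pred ∈ C) : IsCyl C (mod (kb.theory i)) := by
  refine isCyl_mod isFirstOrder_of_mem_theory ?_
  rintro _ (⟨a, ha, rfl⟩ | ⟨p, hp, rfl⟩)
  · exact hont a ha
  · exact singleton_subset_iff.2 (hprog _ hp)

theorem IsBasicModel.isCyl {C : Set σ.Pred} (h : kb.IsBasicModel M)
    (hont : ∀ i, ∀ a ∈ (kb i).ont, L.preds a ⊆ C)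
    (hprog : ∀ i, ∀ r ∈ (kb i).prog, r.head.pred ∈ C) : IsCyl C M := by
  obtain ⟨-, ⟨-, -, rfl⟩ | ⟨-, I, hI, rfl⟩⟩ := h
  · exact isCyl_updateSeq fun i => isCyl_mod_theory (hont i) (hprog i)
  · exact hI.isCyl_Ici hprog

theorem IsProgBased.mod_theory (h : kb.IsProgBased) (i : Fin n) :
    mod (kb.theory i) = Ici (kb.facts i) := by
  ext J
  rw [mem_mod_iff isFirstOrder_of_mem_theory]
  refine ⟨fun hJ p hp => hJ _ (.inr ⟨p, hp, rfl⟩), ?_⟩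
  rintro hJ _ (⟨a, ha, -⟩ | ⟨p, hp, rfl⟩)
  · exact absurd ha (h i ▸ notMem_empty a)
  · exact hJ hp

theorem IsProgBased.isMinimalChangeModel_iff (h : kb.IsProgBased) :
    IsMinimalChangeModel kb.theory M ↔ M = Ici (⋃ i, kb.facts i) := by
  rw [IsMinimalChangeModel, funext h.mod_theory, updateSeq_Ici]
  exact and_iff_right_of_imp fun hM => hM ▸ nonempty_Ici

theorem IsOntBased.prog_eq (h : kb.IsOntBased) (i : Fin n) :
    (kb i).prog = fact '' (Literal.pos '' kb.facts i) := by
  refine Subset.antisymm (fun r hr => ?_) ?_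
  · obtain ⟨⟨p, hp⟩, hb⟩ := h i r hr
    obtain rfl : r = fact (.pos p) := by cases r; cases hp; cases hb; rfl
    exact ⟨_, ⟨p, hr, rfl⟩, rfl⟩
  · rintro _ ⟨_, ⟨p, hp, rfl⟩, rfl⟩
    exact hp

theorem IsOntBased.isDynamicStableModel_iff (h : kb.IsOntBased) {I : Interp σ} :
    IsDynamicStableModel (fun i => (kb i).prog) I ↔ I = ⋃ i, kb.facts i := by
  simp only [h.prog_eq]
  change literals I = least (rulesInForce _ I) ↔ _
  rw [rulesInForce_fact, least_fact, literals_injective.eq_iff]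

theorem isMinimalChangeModel_iff_exists_isDynamicStableModel (hO : kb.IsOntBased)
    (hP : kb.IsProgBased) :
    IsMinimalChangeModel kb.theory M ↔
      ∃ I, IsDynamicStableModel (fun i => (kb i).prog) I ∧ M = Ici I := by
  simp only [hP.isMinimalChangeModel_iff, hO.isDynamicStableModel_iff, exists_eq_left]

theorem IsOntBased.isBasicModel_iff (h : kb.IsOntBased) (hM : M.Nonempty) :
    kb.IsBasicModel M ↔ M = updateSeq n fun i => mod (kb.theory i) := by
  have hiff : kb.IsBasicModel M ↔ IsMinimalChangeModel kb.theory M :=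
    (and_iff_right hM).trans ((or_congr_left (and_iff_right h)).trans (or_iff_left_of_imp
      fun ⟨hP, hI⟩ => (isMinimalChangeModel_iff_exists_isDynamicStableModel h hP).2 hI))
  exact hiff.trans (and_iff_right hM)

theorem IsProgBased.isBasicModel_iff (h : kb.IsProgBased) (hM : M.Nonempty) :
    kb.IsBasicModel M ↔ ∃ I, IsDynamicStableModel (fun i => (kb i).prog) I ∧ M = Ici I :=
  (and_iff_right hM).trans ((or_congr_right (and_iff_right h)).trans (or_iff_right_of_imp
    fun ⟨hO, hI⟩ => (isMinimalChangeModel_iff_exists_isDynamicStableModel hO h).1 hI))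

end DynamicKB

/-! ### Layers -/

/-- The layer of a hybrid knowledge base that concerns the predicate symbols in `C`, the body
literals with other predicate symbols being evaluated in `I`. -/
def HybridKB.layer (C : Set σ.Pred) (I : Interp σ) (K : HybridKB L) : HybridKB L where
  ont := {a ∈ K.ont | L.preds a ⊆ C}
  prog := partialEval C (literals I) K.prog

theorem fact_mem_partialEval_iff {C : Set σ.Pred} {T : Set (Literal σ)} {P : Set (Rule σ)}
    (hP : ∀ r ∈ P, r.head.pred ∈ C → ∀ K ∈ r.body, K.pred ∉ C) {H : Literal σ} :
    fact H ∈ partialEval C T P ↔ H.pred ∈ C ∧ ∃ r ∈ P, r.head = H ∧ ∀ K ∈ r.body, K ∈ T := by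
  constructor
  · rintro ⟨r, ⟨hr, hC, hT⟩, hrH⟩
    obtain rfl : r.head = H := congrArg Rule.head hrH
    exact ⟨hC, r, hr, rfl, fun K hK => hT K hK (hP r hr hC K hK)⟩
  · rintro ⟨hC, r, hr, rfl, hT⟩
    have hbody : (r.restrict C).body = ∅ := Finset.eq_empty_of_forall_notMem fun K hK =>
      have hK := Rule.mem_body_restrict.1 hK
      hP r hr hC K hK.1 hK.2
    exact ⟨r, ⟨hr, hC, fun K hK _ => hT K hK⟩, congrArg (Rule.mk r.head) hbody⟩

namespace DynamicKB

variable {kb : DynamicKB L n} {C D : Set σ.Pred} {I : Interp σ} {M : Set (Interp σ)}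

/-- The componentwise layer of a dynamic hybrid knowledge base. -/
def layer (C : Set σ.Pred) (I : Interp σ) (kb : DynamicKB L n) : DynamicKB L n :=
  fun i => (kb i).layer C I

/-- On the predicate symbols in `C`, the set `M` is a dynamic MKNF model of the layer of `kb` over
`C`, in which literals with other predicate symbols are evaluated in the ground atoms known in
`M`. -/
def IsLocalModel (kb : DynamicKB L n) (C : Set σ.Pred) (M : Set (Interp σ)) : Prop :=
  (kb.layer C (⋂₀ M)).IsBasicModel (cyl C M)

/-- The rules with head in `C` become positive facts in the layer over `C`. -/
def IsOntReducibleOn (kb : DynamicKB L n) (C : Set σ.Pred) : Prop :=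
  ∀ i, ∀ r ∈ (kb i).prog, r.head.pred ∈ C → r.IsPositive ∧ ∀ K ∈ r.body, K.pred ∉ C

/-- The layer over `C` contains no axioms. -/
def IsProgReducibleOn (kb : DynamicKB L n) (C : Set σ.Pred) : Prop :=
  ∀ i, ∀ a ∈ (kb i).ont, ¬ L.preds a ⊆ C

theorem IsOntReducibleOn.mono (hCD : C ⊆ D) (h : kb.IsOntReducibleOn D) :
    kb.IsOntReducibleOn C := fun i r hr hC =>
  have hrD := h i r hr (hCD hC)
  ⟨hrD.1, fun K hK hKC => hrD.2 K hK (hCD hKC)⟩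

theorem IsProgReducibleOn.mono (hCD : C ⊆ D) (h : kb.IsProgReducibleOn D) :
    kb.IsProgReducibleOn C := fun i a ha hC => h i a ha (hC.trans hCD)

theorem isProgReducibleOn_empty : kb.IsProgReducibleOn ∅ := fun _ a _ h =>
  (Formula.preds_nonempty (L.fo a).1).ne_empty (subset_empty_iff.1 h)

theorem isCyl_mod_theory_layer (kb : DynamicKB L n) (C : Set σ.Pred) (I : Interp σ) (i : Fin n) :
    IsCyl C (mod ((kb.layer C I).theory i)) := by
  refine isCyl_mod_theory (fun a ha => ha.2) ?_
  rintro _ ⟨r, hr, rfl⟩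
  exact hr.2.1

theorem IsOntReducibleOn.isLocalModel_iff (h : kb.IsOntReducibleOn C) (hM : M.Nonempty) :
    kb.IsLocalModel C M ↔
      cyl C M = updateSeq n fun i => mod ((kb.layer C (⋂₀ M)).theory i) := by
  refine IsOntBased.isBasicModel_iff ?_ (hM.mono (subset_cyl C M))
  rintro i _ ⟨r, ⟨hr, hC, -⟩, rfl⟩
  refine ⟨(h i r hr hC).1, Finset.eq_empty_of_forall_notMem fun K hK => ?_⟩
  rw [Rule.mem_body_restrict] at hK
  exact (h i r hr hC).2 K hK.1 hK.2

theorem IsProgReducibleOn.isLocalModel_iff (h : kb.IsProgReducibleOn C) (hM : M.Nonempty) :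
    kb.IsLocalModel C M ↔ cyl C M = Ici (restrict C (⋂₀ M)) ∧
      IsLeastOn (literals (⋂₀ M)) (rulesInForce (fun i => (kb i).prog) (⋂₀ M)) C := by
  have hbased : (kb.layer C (⋂₀ M)).IsProgBased := fun i =>
    eq_empty_of_forall_notMem fun a ha => h i a ha.1 ha.2
  rw [IsLocalModel, hbased.isBasicModel_iff (hM.mono (subset_cyl C M)),
    ← isDynamicStableModel_partialEval_iff, and_comm]
  constructor
  · rintro ⟨I, hI, hcyl⟩
    obtain rfl : restrict C (⋂₀ M) = I := by
      rw [← sInter_cyl hM, hcyl]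
      exact csInf_Ici
    exact ⟨hI, hcyl⟩
  · exact fun h => ⟨_, h⟩

theorem isLocalModel_empty (hM : M.Nonempty) : kb.IsLocalModel ∅ M := by
  refine (isProgReducibleOn_empty.isLocalModel_iff hM).2 ⟨?_, ?_⟩
  · rw [cyl_empty hM]
    exact (eq_univ_of_forall fun _ _ hp => hp.2.elim).symm
  · rw [IsLeastOn, preimage_empty, inter_empty, eq_comm, ← subset_empty_iff]
    exact least_partialEval_subset_preimage

end DynamicKB

/-! ### Stratifications -/

namespace DynamicKB

variable {κ : Type*} {κ' : Type*} {kb : DynamicKB L n} {D : Set σ.Pred} {I : Interp σ}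
  {M : Set (Interp σ)}

/-- The layer of `kb` over `C` is basic: it is reducible to one over which either every rule is a
positive fact or there are no axioms. -/
def IsReducibleOn (kb : DynamicKB L n) (C : Set σ.Pred) : Prop :=
  kb.IsOntReducibleOn C ∨ kb.IsProgReducibleOn C

/-- A ranking of the predicate symbols that is constant on axioms, never larger on the body of
a rule than on its head, and such that the symbols of each rank form a basic layer. A splitting
sequence yields one by ranking each symbol by the least index at which it appears. -/
structure IsStratification [LE κ] (kb : DynamicKB L n) (ρ : σ.Pred → κ) : Prop where
  ont : ∀ i, ∀ a ∈ (kb i).ont, ∀ P ∈ L.preds a, ∀ Q ∈ L.preds a, ρ P = ρ Q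
  prog : ∀ i, ∀ r ∈ (kb i).prog, ∀ K ∈ r.body, ρ K.pred ≤ ρ r.head.pred
  reducible : ∀ j, kb.IsReducibleOn (ρ ⁻¹' {j})

/-- `M` is the product of its projections to the layers of `ρ`, and each projection is a dynamic
MKNF model of its layer. -/
def IsStratifiedModel (kb : DynamicKB L n) (ρ : σ.Pred → κ) (M : Set (Interp σ)) : Prop :=
  M.Nonempty ∧ M = ⋂ j, cyl (ρ ⁻¹' {j}) M ∧ ∀ j, kb.IsLocalModel (ρ ⁻¹' {j}) M

theorem pairwise_disjoint_inter_fiber (D : Set σ.Pred) (τ : σ.Pred → κ) :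
    Pairwise (Disjoint on fun j => D ∩ τ ⁻¹' {j}) := fun _ _ hij =>
  (pairwise_disjoint_fiber τ hij).mono inter_subset_right inter_subset_right

theorem IsOntReducibleOn.layer_theory_eq_iUnion (h : kb.IsOntReducibleOn D) {τ : σ.Pred → κ}
    (hont : ∀ i, ∀ a ∈ (kb i).ont, ∀ P ∈ L.preds a, ∀ Q ∈ L.preds a, τ P = τ Q) (i : Fin n) :
    (kb.layer D I).theory i = ⋃ j, (kb.layer (D ∩ τ ⁻¹' {j}) I).theory i := by
  have hfact (C : Set σ.Pred) (hCD : C ⊆ D) (H : Literal σ) :=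
    fact_mem_partialEval_iff (T := literals I) (H := H)
      fun r hr hC => (h.mono hCD i r hr hC).2
  refine Subset.antisymm ?_ (iUnion_subset fun j => ?_)
  · rintro _ (⟨a, ⟨ha, haD⟩, rfl⟩ | ⟨p, hp, rfl⟩)
    · obtain ⟨P, hP⟩ := Formula.preds_nonempty (L.fo a).1
      exact mem_iUnion.2 ⟨τ P, .inl ⟨a, ⟨ha, fun Q hQ => ⟨haD hQ, hont i a ha Q hQ P hP⟩⟩, rfl⟩⟩
    · obtain ⟨hpD, hr⟩ := (hfact D Subset.rfl _).1 hp
      exact mem_iUnion.2 ⟨τ p.pred, .inr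
        ⟨p, (hfact _ inter_subset_left _).2 ⟨⟨hpD, rfl⟩, hr⟩, rfl⟩⟩
  · rintro _ (⟨a, ⟨ha, haD⟩, rfl⟩ | ⟨p, hp, rfl⟩)
    · exact .inl ⟨a, ⟨ha, haD.trans inter_subset_left⟩, rfl⟩
    · obtain ⟨hpD, hr⟩ := (hfact _ inter_subset_left _).1 hp
      exact .inr ⟨p, (hfact D Subset.rfl _).2 ⟨hpD.1, hr⟩, rfl⟩

theorem IsOntReducibleOn.isLocalModel_iff_forall (h : kb.IsOntReducibleOn D) {τ : σ.Pred → κ}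
    (hont : ∀ i, ∀ a ∈ (kb i).ont, ∀ P ∈ L.preds a, ∀ Q ∈ L.preds a, τ P = τ Q)
    (hM : M.Nonempty) :
    kb.IsLocalModel D M ↔ cyl D M = ⋂ j, cyl (D ∩ τ ⁻¹' {j}) M ∧
      ∀ j, kb.IsLocalModel (D ∩ τ ⁻¹' {j}) M := by
  have hcyl (j : κ) (i : Fin n) := isCyl_mod_theory_layer kb (D ∩ τ ⁻¹' {j}) (⋂₀ M) i
  have hmod (i : Fin n) : mod ((kb.layer D (⋂₀ M)).theory i) =
      ⋂ j, mod ((kb.layer (D ∩ τ ⁻¹' {j}) (⋂₀ M)).theory i) := by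
    rw [h.layer_theory_eq_iUnion hont, mod_iUnion fun j => isFirstOrder_of_mem_theory]
  have hdisj := pairwise_disjoint_inter_fiber D τ
  rw [h.isLocalModel_iff hM, funext hmod, updateSeq_iInter hdisj hcyl,
    cyl_eq_iInter_iff hdisj (fun _ => inter_subset_left) (fun j => isCyl_updateSeq (hcyl j)) hM]
  exact and_congr_right' <| forall_congr' fun j =>
    ((h.mono inter_subset_left).isLocalModel_iff hM).symm

theorem Ici_restrict_eq_iInter (D : Set σ.Pred) (τ : σ.Pred → κ) (I : Interp σ) :
    Ici (restrict D I) = ⋂ j, Ici (restrict (D ∩ τ ⁻¹' {j}) I) := by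
  ext J
  refine ⟨fun hJ => mem_iInter.2 fun j p hp => hJ ⟨hp.1, hp.2.1⟩, fun hJ p hp => ?_⟩
  exact mem_iInter.1 hJ (τ p.pred) ⟨hp.1, hp.2, rfl⟩

theorem IsProgReducibleOn.isLocalModel_iff_forall [PartialOrder κ] [WellFoundedLT κ]
    (h : kb.IsProgReducibleOn D) {τ : σ.Pred → κ}
    (hprog : ∀ i, ∀ r ∈ (kb i).prog, ∀ K ∈ r.body, τ K.pred ≤ τ r.head.pred)
    (hM : M.Nonempty) :
    kb.IsLocalModel D M ↔ cyl D M = ⋂ j, cyl (D ∩ τ ⁻¹' {j}) M ∧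
      ∀ j, kb.IsLocalModel (D ∩ τ ⁻¹' {j}) M := by
  have hbody : ∀ r ∈ rulesInForce (fun i => (kb i).prog) (⋂₀ M), ∀ K ∈ r.body,
      τ K.pred ≤ τ r.head.pred := by
    rintro r (⟨i, hr, -⟩ | ⟨p, rfl, -⟩) K hK
    · exact hprog i r hr K hK
    · exact absurd hK (Finset.notMem_empty K)
  rw [h.isLocalModel_iff hM, isLeastOn_iff_forall hbody, Ici_restrict_eq_iInter D τ,
    cyl_eq_iInter_iff (pairwise_disjoint_inter_fiber D τ) (fun _ => inter_subset_left)
      (fun j => isCyl_Ici_restrict _ _) hM, and_assoc, ← forall_and]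
  exact and_congr_right' <| forall_congr' fun j =>
    ((h.mono inter_subset_left).isLocalModel_iff hM).symm

theorem IsStratification.isLocalModel_iff_forall [PartialOrder κ] [WellFoundedLT κ]
    {τ : σ.Pred → κ} (hτ : kb.IsStratification τ) (hD : kb.IsReducibleOn D) (hM : M.Nonempty) :
    kb.IsLocalModel D M ↔ cyl D M = ⋂ j, cyl (D ∩ τ ⁻¹' {j}) M ∧
      ∀ j, kb.IsLocalModel (D ∩ τ ⁻¹' {j}) M :=
  hD.elim (fun h => h.isLocalModel_iff_forall hτ.ont hM)
    fun h => h.isLocalModel_iff_forall hτ.prog hM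

theorem IsStratification.isStratifiedModel_iff_refinement [LE κ] [PartialOrder κ']
    [WellFoundedLT κ'] {ρ : σ.Pred → κ} {τ : σ.Pred → κ'} (hρ : kb.IsStratification ρ)
    (hτ : kb.IsStratification τ) :
    kb.IsStratifiedModel ρ M ↔ M.Nonempty ∧ M = ⋂ a, ⋂ b, cyl (ρ ⁻¹' {a} ∩ τ ⁻¹' {b}) M ∧
      ∀ a b, kb.IsLocalModel (ρ ⁻¹' {a} ∩ τ ⁻¹' {b}) M := by
  refine and_congr_right fun hM => ?_
  have hcyl (a : κ) : IsCyl (ρ ⁻¹' {a}) (⋂ b, cyl (ρ ⁻¹' {a} ∩ τ ⁻¹' {b}) M) :=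
    IsCyl.iInter fun b => (isCyl_cyl _ M).mono inter_subset_left
  rw [eq_iInter_iff (pairwise_disjoint_fiber ρ) hcyl hM, and_assoc, ← forall_and]
  exact and_congr_right' <| forall_congr' fun a =>
    hτ.isLocalModel_iff_forall (hρ.reducible a) hM

theorem IsStratification.isStratifiedModel_iff [PartialOrder κ] [WellFoundedLT κ]
    [PartialOrder κ'] [WellFoundedLT κ'] {ρ : σ.Pred → κ} {τ : σ.Pred → κ'}
    (hρ : kb.IsStratification ρ) (hτ : kb.IsStratification τ) :
    kb.IsStratifiedModel ρ M ↔ kb.IsStratifiedModel τ M := by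
  rw [hρ.isStratifiedModel_iff_refinement hτ, hτ.isStratifiedModel_iff_refinement hρ,
    iInter_comm, forall_comm]
  simp only [inter_comm]

end DynamicKB

/-! ### Splitting sets -/

theorem models_toMKNF_iff {X : Set (Interp σ)} (hX : X.Nonempty) {S : Set (Literal σ)} :
    Models X (Literal.toMKNF '' S) ↔ S ⊆ literals (⋂₀ X) := by
  have hsat (K : Literal σ) (I : Interp σ) :
      K.toMKNF.Sat Fin.elim0 I X X ↔ K ∈ literals (⋂₀ X) := by
    cases K with
    | pos p => exact Iff.rfl
    | dneg p => exact (not_forall.trans (exists_congr fun _ => Classical.not_imp)).symm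
  simp only [Models, forall_mem_image, hsat]
  exact ⟨fun h K hK => h hK _ hX.some_mem, fun h K hK _ _ => h hK⟩

theorem Rule.bodyPreds_subset_iff {r : Rule σ} {C : Set σ.Pred} :
    r.bodyPreds ⊆ C ↔ ∀ K ∈ r.body, K.pred ∈ C := by
  simp only [Rule.bodyPreds, Literal.preds_eq, iUnion_subset_iff, singleton_subset_iff]

theorem Rule.preds_subset_iff {r : Rule σ} {C : Set σ.Pred} :
    r.preds ⊆ C ↔ r.head.pred ∈ C ∧ ∀ K ∈ r.body, K.pred ∈ C := by
  rw [Rule.preds, union_subset_iff, Rule.bodyPreds_subset_iff, Literal.preds_eq,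
    singleton_subset_iff]

theorem Rule.eq_restrict_iff {r r' : Rule σ} {C : Set σ.Pred} :
    r' = r.restrict C ↔ r'.head = r.head ∧ ∀ K, K ∈ r'.body ↔ K ∈ r.body ∧ K.pred ∈ C := by
  refine ⟨by rintro rfl; simp, fun ⟨hhead, hbody⟩ => ?_⟩
  cases r'
  cases hhead
  exact congrArg _ (Finset.ext fun K => (hbody K).trans Rule.mem_body_restrict.symm)

theorem Rule.restrict_eq_self {r : Rule σ} {C : Set σ.Pred} (h : ∀ K ∈ r.body, K.pred ∈ C) :
    r.restrict C = r :=
  (Rule.eq_restrict_iff.2 ⟨rfl, fun K => (and_iff_left_of_imp (h K)).symm⟩).symm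

namespace HybridKB.IsSplittingSet

variable {K : HybridKB L} {U V : Set σ.Pred} {I : Interp σ}

theorem preds_subset_iff (h : K.IsSplittingSet U) {r : Rule σ} (hr : r ∈ K.prog) :
    r.preds ⊆ U ↔ r.head.pred ∈ U :=
  ⟨fun hs => (Rule.preds_subset_iff.1 hs).1,
    fun hs => h.2 r hr ⟨_, by rw [Literal.preds_eq]; rfl, hs⟩⟩

theorem pred_mem_of_mem_body (h : K.IsSplittingSet U) {r : Rule σ} (hr : r ∈ K.prog)
    (hhead : r.head.pred ∈ U) {H : Literal σ} (hH : H ∈ r.body) : H.pred ∈ U :=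
  (Rule.preds_subset_iff.1 ((h.preds_subset_iff hr).2 hhead)).2 H hH

theorem not_ont_preds_subset_iff (h : K.IsSplittingSet U) {a : L.Ax} (ha : a ∈ K.ont) :
    ¬ L.preds a ⊆ U ↔ Disjoint (L.preds a) U := by
  rw [disjoint_iff_inter_eq_empty, ← not_nonempty_iff_eq_empty, not_iff_not]
  refine ⟨fun hs => ?_, h.1 a ha⟩
  rw [inter_eq_left.2 hs]
  exact Formula.preds_nonempty (L.fo a).1

theorem mem_ont_top_bottom_iff (h : K.IsSplittingSet U) {a : L.Ax} :
    a ∈ ((K.bottom V).top U).ont ↔ a ∈ K.ont ∧ L.preds a ⊆ V \ U := by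
  change (a ∈ K.ont ∧ _) ∧ ¬ ((a ∈ K.ont ∧ _) ∧ _) ↔ _
  rw [subset_sdiff]
  constructor
  · rintro ⟨⟨ha, haV⟩, haU⟩
    exact ⟨ha, haV, (h.not_ont_preds_subset_iff ha).1 fun hs => haU ⟨⟨ha, haV⟩, hs⟩⟩
  · rintro ⟨ha, haV, haU⟩
    exact ⟨⟨ha, haV⟩, fun hs => (h.not_ont_preds_subset_iff ha).2 haU hs.2⟩

theorem mem_prog_top_bottom_iff (hU : K.IsSplittingSet U) (hV : K.IsSplittingSet V)
    {r : Rule σ} :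
    r ∈ ((K.bottom V).top U).prog ↔ r ∈ K.prog ∧ r.head.pred ∈ V \ U := by
  change (r ∈ K.prog ∧ _) ∧ ¬ ((r ∈ K.prog ∧ _) ∧ _) ↔ _
  by_cases hr : r ∈ K.prog
  · rw [hU.preds_subset_iff hr, hV.preds_subset_iff hr, mem_sdiff]
    tauto
  · tauto

theorem bottom_eq_layer (h : K.IsSplittingSet U) : K.bottom U = K.layer U I := by
  refine congrArg (HybridKB.mk _) (Subset.antisymm ?_ ?_)
  · rintro r ⟨hr, hs⟩
    rw [Rule.preds_subset_iff] at hs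
    exact ⟨r, ⟨hr, hs.1, fun H hH hHU => absurd (hs.2 H hH) hHU⟩, Rule.restrict_eq_self hs.2⟩
  · rintro _ ⟨r, ⟨hr, hhead, -⟩, rfl⟩
    rw [Rule.restrict_eq_self fun H hH => h.pred_mem_of_mem_body hr hhead hH]
    exact ⟨hr, (h.preds_subset_iff hr).2 hhead⟩

theorem head_pred_mem_of_mem_prog_reduct (hU : K.IsSplittingSet U) (hV : K.IsSplittingSet V)
    {X : Set (Interp σ)} {r : Rule σ} (hr : r ∈ ((K.bottom V).reduct U X).prog) :
    r.head.pred ∈ V \ U := by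
  obtain ⟨r', hr', -, hhead, -⟩ := hr
  exact hhead ▸ ((hU.mem_prog_top_bottom_iff hV).1 hr').2

theorem reduct_bottom_eq_layer (hU : K.IsSplittingSet U) (hV : K.IsSplittingSet V)
    {X : Set (Interp σ)} (hX : X.Nonempty) (hI : AgreeOn U (⋂₀ X) I) :
    (K.bottom V).reduct U X = K.layer (V \ U) I := by
  have hont : ((K.bottom V).reduct U X).ont = (K.layer (V \ U) I).ont :=
    Set.ext fun a => hU.mem_ont_top_bottom_iff
  have hprog : ((K.bottom V).reduct U X).prog = (K.layer (V \ U) I).prog := by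
    ext r'
    refine exists_congr fun r => ?_
    rw [hU.mem_prog_top_bottom_iff hV, models_toMKNF_iff hX, and_assoc, mem_ofPred_eq, and_assoc,
      and_assoc, eq_comm (b := r'), Rule.eq_restrict_iff]
    refine and_congr_right fun hr => and_congr_right fun hhead => ?_
    have hmem {H : Literal σ} (hH : H ∈ r.body) : H.pred ∈ V \ U ↔ H.pred ∉ U :=
      and_iff_right (hV.pred_mem_of_mem_body hr hhead.1 hH)
    simp only [Literal.preds_eq, singleton_subset_iff, mem_compl_iff]
    refine and_congr (forall_congr' fun H => ?_) (and_congr_right' <| forall_congr' fun H => ?_)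
    · rw [mem_ofPred_eq, and_imp]
      refine forall_congr' fun hH => ?_
      rw [hmem hH, not_not]
      exact forall_congr' fun hHU => Literal.holds_congr hI hHU
    · exact iff_congr Iff.rfl (and_congr_right fun hH => (hmem hH).symm)
  exact congrArg₂ HybridKB.mk hont hprog

end HybridKB.IsSplittingSet

namespace DynamicKB

variable {kb : DynamicKB L n} {U V : Set σ.Pred}

theorem IsReducible.isReducibleOn_of_bottom (hU : ∀ i, (kb i).IsSplittingSet U)
    (h : (kb.bottom U).IsReducible ∅) : kb.IsReducibleOn U := by
  refine h.imp (fun h i r hr hhead => ?_) fun h i a ha hs => ?_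
  · obtain ⟨hpos, hbody⟩ := h i r ⟨hr, ((hU i).preds_subset_iff hr).2 hhead⟩
    exact ⟨hpos, fun K hK => (Rule.bodyPreds_subset_iff.1 hbody K hK).elim⟩
  · exact (h i).subset (show a ∈ ((kb i).bottom U).ont from ⟨ha, hs⟩)

theorem IsReducible.isReducibleOn_of_top_bottom (hU : ∀ i, (kb i).IsSplittingSet U)
    (hV : ∀ i, (kb i).IsSplittingSet V) (h : ((kb.bottom V).top U).IsReducible U) :
    kb.IsReducibleOn (V \ U) := by
  refine h.imp (fun h i r hr hhead => ?_) fun h i a ha hs => ?_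
  · obtain ⟨hpos, hbody⟩ := h i r (((hU i).mem_prog_top_bottom_iff (hV i)).2 ⟨hr, hhead⟩)
    exact ⟨hpos, fun K hK hKU => hKU.2 (Rule.bodyPreds_subset_iff.1 hbody K hK)⟩
  · exact (h i).subset ((hU i).mem_ont_top_bottom_iff.2 ⟨ha, hs⟩)

end DynamicKB

/-! ### Splitting sequences -/

/-- The least index `α` with `P ∈ U_α`. -/
noncomputable def PredSeq.rank (U : PredSeq.{u, v, o} σ) (P : σ.Pred) : Ordinal.{o} :=
  sInf {α | P ∈ U.set α}

namespace HybridKB.IsSplittingSequence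

variable {K : HybridKB L} {U : PredSeq.{u, v, o} σ}

theorem rank_lt_length_and_mem (h : K.IsSplittingSequence U) (P : σ.Pred) :
    U.rank P < U.length ∧ P ∈ U.set (U.rank P) := by
  have hP : P ∈ ⋃ α < U.length, U.set α := h.union ▸ mem_univ P
  obtain ⟨α, hα, hP⟩ := mem_iUnion₂.1 hP
  exact ⟨(csInf_le' (s := {α | P ∈ U.set α}) hP).trans_lt hα,
    csInf_mem (s := {α | P ∈ U.set α}) ⟨α, hP⟩⟩

theorem mem_set_iff_rank_le (h : K.IsSplittingSequence U) {P : σ.Pred} {α : Ordinal.{o}}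
    (hα : α < U.length) : P ∈ U.set α ↔ U.rank P ≤ α :=
  ⟨fun hP => csInf_le' hP, fun hP => h.monotone _ _ hP hα (h.rank_lt_length_and_mem P).2⟩

theorem rank_preimage_zero (h : K.IsSplittingSequence U) (h0 : 0 < U.length) :
    U.rank ⁻¹' {0} = U.set 0 :=
  ext fun _ => nonpos_iff_eq_zero.symm.trans (h.mem_set_iff_rank_le h0).symm

theorem rank_preimage_succ (h : K.IsSplittingSequence U) {α : Ordinal.{o}}
    (hα : succ α < U.length) : U.rank ⁻¹' {succ α} = U.set (succ α) \ U.set α := by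
  ext P
  rw [mem_sdiff, h.mem_set_iff_rank_le hα, h.mem_set_iff_rank_le ((lt_succ α).trans hα), not_le,
    ← succ_le_iff, ← le_antisymm_iff, mem_preimage, mem_singleton_iff]

theorem rank_preimage_of_isSuccLimit (h : K.IsSplittingSequence U) {α : Ordinal.{o}}
    (hα : IsSuccLimit α) : U.rank ⁻¹' {α} = ∅ := by
  refine eq_empty_of_forall_notMem ?_
  rintro P rfl
  obtain ⟨hlt, hP⟩ := h.rank_lt_length_and_mem P
  rw [h.continuous _ hlt hα] at hP
  obtain ⟨η, hη, hP⟩ := mem_iUnion₂.1 hP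
  exact hη.not_ge (csInf_le' hP)

theorem rank_preimage_of_length_le (h : K.IsSplittingSequence U) {α : Ordinal.{o}}
    (hα : U.length ≤ α) : U.rank ⁻¹' {α} = ∅ := by
  refine eq_empty_of_forall_notMem ?_
  rintro P rfl
  exact hα.not_gt (h.rank_lt_length_and_mem P).1

theorem forall_rank_preimage_iff (h : K.IsSplittingSequence U) {p : Set σ.Pred → Prop}
    (hp : p ∅) : (∀ α, p (U.rank ⁻¹' {α})) ↔ (0 < U.length → p (U.set 0)) ∧
      ∀ α, succ α < U.length → p (U.set (succ α) \ U.set α) := by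
  refine ⟨fun hall => ⟨fun h0 => h.rank_preimage_zero h0 ▸ hall 0,
    fun α hα => h.rank_preimage_succ hα ▸ hall (succ α)⟩, fun ⟨hzero, hsucc⟩ α => ?_⟩
  rcases le_or_gt U.length α with hα | hα
  · exact h.rank_preimage_of_length_le hα ▸ hp
  rcases Ordinal.zero_or_succ_or_isSuccLimit α with rfl | ⟨β, rfl⟩ | hlim
  · exact h.rank_preimage_zero hα ▸ hzero hα
  · exact h.rank_preimage_succ hα ▸ hsucc β hα
  · exact h.rank_preimage_of_isSuccLimit hlim ▸ hp

theorem rank_le_rank_of_mem_ont (h : K.IsSplittingSequence U) {a : L.Ax} (ha : a ∈ K.ont)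
    {P Q : σ.Pred} (hP : P ∈ L.preds a) (hQ : Q ∈ L.preds a) : U.rank P ≤ U.rank Q := by
  obtain ⟨hlt, hmem⟩ := h.rank_lt_length_and_mem Q
  exact (h.mem_set_iff_rank_le hlt).1 ((h.splitting _ hlt).1 a ha ⟨Q, hQ, hmem⟩ hP)

theorem rank_le_rank_of_mem_body (h : K.IsSplittingSequence U) {r : Rule σ} (hr : r ∈ K.prog)
    {H : Literal σ} (hH : H ∈ r.body) : U.rank H.pred ≤ U.rank r.head.pred := by
  obtain ⟨hlt, hmem⟩ := h.rank_lt_length_and_mem r.head.pred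
  exact (h.mem_set_iff_rank_le hlt).1 ((h.splitting _ hlt).pred_mem_of_mem_body hr hmem hH)

end HybridKB.IsSplittingSequence

namespace DynamicKB

variable {kb : DynamicKB L n} {U : PredSeq.{u, v, o} σ} {X : Ordinal.{o} → Set (Interp σ)}
  {M : Set (Interp σ)}

theorem IsUpdateEnabling.isStratification [NeZero n] (h : kb.IsUpdateEnabling U) :
    kb.IsStratification U.rank where
  ont i _ ha _ hP _ hQ := ((h.splitting i).rank_le_rank_of_mem_ont ha hP hQ).antisymm
    ((h.splitting i).rank_le_rank_of_mem_ont ha hQ hP)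
  prog i _ hr _ hK := (h.splitting i).rank_le_rank_of_mem_body hr hK
  reducible := by
    refine ((h.splitting 0).forall_rank_preimage_iff (.inr isProgReducibleOn_empty)).2
      ⟨fun h0 => ?_, fun α hα => ?_⟩
    · exact (h.zero h0).isReducibleOn_of_bottom fun i => (h.splitting i).splitting 0 h0
    · exact (h.succ α hα).isReducibleOn_of_top_bottom
        (fun i => (h.splitting i).splitting α ((lt_succ α).trans hα))
        (fun i => (h.splitting i).splitting _ hα)

theorem IsSolution.isCyl [NeZero n] (hX : kb.IsSolution U X) (h : kb.IsSplittingSequence U)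
    {α : Ordinal.{o}} (hα : α < U.length) : IsCyl (U.rank ⁻¹' {α}) (X α) := by
  rcases Ordinal.zero_or_succ_or_isSuccLimit α with rfl | ⟨β, rfl⟩ | hlim
  · rw [(h 0).rank_preimage_zero hα]
    exact (hX.zero hα).isCyl (fun i a ha => ha.2) fun i r hr => (Rule.preds_subset_iff.1 hr.2).1
  · have hβ : β < U.length := (lt_succ β).trans hα
    rw [(h 0).rank_preimage_succ hα]
    exact (hX.succ β hα).isCyl
      (fun i a ha => (((h i).splitting β hβ).mem_ont_top_bottom_iff.1 ha).2) fun i r hr =>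
        ((h i).splitting β hβ).head_pred_mem_of_mem_prog_reduct ((h i).splitting _ hα) hr
  · rw [hX.limit α hα hlim]
    exact fun _ _ _ _ => mem_univ _

theorem reduct_iInter_eq_layer (h : kb.IsSplittingSequence U) (hM : M.Nonempty)
    (hX : ∀ α < U.length, X α = cyl (U.rank ⁻¹' {α}) M) {α : Ordinal.{o}}
    (hα : succ α < U.length) :
    (kb.bottom (U.set (succ α))).reduct (U.set α) (⋂ η ≤ α, X η) =
      kb.layer (U.set (succ α) \ U.set α) (⋂₀ M) := by
  have hα' : α < U.length := (lt_succ α).trans hα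
  have hsub : M ⊆ ⋂ η ≤ α, X η := subset_iInter₂ fun η hη =>
    hX η (hη.trans_lt hα') ▸ subset_cyl _ M
  funext i
  refine ((h i).splitting α hα').reduct_bottom_eq_layer ((h i).splitting _ hα) (hM.mono hsub)
    fun p hp => ?_
  have hrank : U.rank p.pred ≤ α := ((h i).mem_set_iff_rank_le hα').1 hp
  have hcyl : ⋂ η ≤ α, X η ⊆ cyl (U.rank ⁻¹' {U.rank p.pred}) M :=
    hX _ (hrank.trans_lt hα') ▸ iInter₂_subset (U.rank p.pred) hrank
  exact agreeOn_sInter hsub hcyl p rfl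

theorem isSolution_iff_forall_isLocalModel [NeZero n] (h : kb.IsSplittingSequence U)
    (hM : M.Nonempty) (hX : ∀ α < U.length, X α = cyl (U.rank ⁻¹' {α}) M) :
    kb.IsSolution U X ↔ ∀ α, kb.IsLocalModel (U.rank ⁻¹' {α}) M := by
  have hzero (h0 : 0 < U.length) : (kb.bottom (U.set 0)).IsBasicModel (X 0) ↔
      kb.IsLocalModel (U.set 0) M := by
    have hbottom : kb.bottom (U.set 0) = kb.layer (U.set 0) (⋂₀ M) :=
      funext fun i => ((h i).splitting 0 h0).bottom_eq_layer
    rw [hX 0 h0, (h 0).rank_preimage_zero h0, hbottom, IsLocalModel]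
  have hsucc (α : Ordinal.{o}) (hα : succ α < U.length) :
      ((kb.bottom (U.set (succ α))).reduct (U.set α) (⋂ η ≤ α, X η)).IsBasicModel (X (succ α)) ↔
        kb.IsLocalModel (U.set (succ α) \ U.set α) M := by
    rw [reduct_iInter_eq_layer h hM hX hα, hX _ hα, (h 0).rank_preimage_succ hα, IsLocalModel]
  rw [(h 0).forall_rank_preimage_iff (p := fun C => kb.IsLocalModel C M) (isLocalModel_empty hM)]
  constructor
  · exact fun hsol => ⟨fun h0 => (hzero h0).1 (hsol.zero h0),
      fun α hα => (hsucc α hα).1 (hsol.succ α hα)⟩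
  · rintro ⟨hloc₀, hloc⟩
    refine ⟨fun α hα => hX α hα ▸ hM.mono (subset_cyl _ M), fun h0 => (hzero h0).2 (hloc₀ h0),
      fun α hα => (hsucc α hα).2 (hloc α hα), fun α hα hlim => ?_⟩
    rw [hX α hα, (h 0).rank_preimage_of_isSuccLimit hlim, cyl_empty hM]

theorem isDynamicModelWrt_iff_isStratifiedModel [NeZero n] (h : kb.IsSplittingSequence U) :
    kb.IsDynamicModelWrt U M ↔ kb.IsStratifiedModel U.rank M := by
  refine and_congr_right fun hM => ?_
  constructor
  · rintro ⟨X, hX, hMX⟩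
    obtain ⟨hprod, hcyl⟩ := (eq_iInter_iff (pairwise_disjoint_fiber U.rank)
      (fun α => IsCyl.iInter fun hα => hX.isCyl h hα) hM).1 hMX
    refine ⟨hprod, (isSolution_iff_forall_isLocalModel h hM fun α hα => ?_).1 hX⟩
    simp only [hcyl, hα, iInter_true]
  · rintro ⟨hprod, hloc⟩
    refine ⟨_, (isSolution_iff_forall_isLocalModel h hM fun _ _ => rfl).2 hloc, hprod.trans ?_⟩
    refine iInter_congr fun α => ?_
    rcases lt_or_ge α U.length with hα | hα
    · simp only [hα, iInter_true]
    · rw [(h 0).rank_preimage_of_length_le hα, cyl_empty hM, iInter_univ]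

theorem isBasicModel_iff_eq_univ {kb : DynamicKB L 0} : kb.IsBasicModel M ↔ M = univ := by
  have hiff (hM : M.Nonempty) : kb.IsBasicModel M ↔ M = univ :=
    IsOntBased.isBasicModel_iff (fun i => i.elim0) hM
  exact ⟨fun h => (hiff h.1).1 h, fun h => (hiff (h ▸ univ_nonempty)).2 h⟩

theorem isDynamicModelWrt_iff_eq_univ {kb : DynamicKB L 0} :
    kb.IsDynamicModelWrt U M ↔ M = univ := by
  constructor
  · rintro ⟨-, X, hX, rfl⟩
    refine iInter_eq_univ.2 fun α => iInter_eq_univ.2 fun hα => ?_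
    rcases Ordinal.zero_or_succ_or_isSuccLimit α with rfl | ⟨β, rfl⟩ | hlim
    · exact isBasicModel_iff_eq_univ.1 (hX.zero hα)
    · exact isBasicModel_iff_eq_univ.1 (hX.succ β hα)
    · exact hX.limit α hα hlim
  · rintro rfl
    have hsol : kb.IsSolution U fun _ => univ :=
      ⟨fun _ _ => univ_nonempty, fun _ => isBasicModel_iff_eq_univ.2 rfl,
        fun _ _ => isBasicModel_iff_eq_univ.2 rfl, fun _ _ _ => rfl⟩
    exact ⟨univ_nonempty, _, hsol, by simp only [iInter_univ]⟩

theorem IsUpdateEnabling.isDynamicModelWrt_iff {V : PredSeq.{u, v, o'} σ}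
    (hU : kb.IsUpdateEnabling U) (hV : kb.IsUpdateEnabling V) :
    kb.IsDynamicModelWrt U M ↔ kb.IsDynamicModelWrt V M := by
  cases n with
  | zero => rw [isDynamicModelWrt_iff_eq_univ, isDynamicModelWrt_iff_eq_univ]
  | succ n =>
    rw [isDynamicModelWrt_iff_isStratifiedModel hU.splitting,
      isDynamicModelWrt_iff_isStratifiedModel hV.splitting,
      hU.isStratification.isStratifiedModel_iff hV.isStratification]

end DynamicKB

end HybridMKNF

theorem mainTheorem3 {σ : HybridMKNF.Signature.{u, v}}
    {L : HybridMKNF.DescriptionLogic.{u, v, w} σ} {n : ℕ} (kb : HybridMKNF.DynamicKB L n)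
    (U : HybridMKNF.PredSeq.{u, v, o} σ) (V : HybridMKNF.PredSeq.{u, v, o'} σ)
    (hU : kb.IsUpdateEnabling U) (hV : kb.IsUpdateEnabling V) :
    (∀ M : Set (HybridMKNF.Interp σ), kb.IsDynamicModelWrt U M ↔ kb.IsDynamicModelWrt V M) ∧
      ∀ M : Set (HybridMKNF.Interp σ),
        HybridMKNF.DynamicKB.IsDynamicModel.{u, v, w, o} kb M ↔ kb.IsDynamicModelWrt U M := by
  refine ⟨fun M => hU.isDynamicModelWrt_iff hV, fun M => ⟨?_, fun h => ⟨U, hU, h⟩⟩⟩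
  rintro ⟨W, hW, hM⟩
  exact (hW.isDynamicModelWrt_iff hU).1 hM
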